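/- **Setting.** A *diagram* on $n$ strands is a partition $a$ of $n$ top points and $n$ bottom points placed on the boundary of a rectangle; it is *planar* if no two of its blocks cross. Placing $a$ on top of $b$ and identifying the bottom points of $a$ with the top points of $b$ gives a diagram $ab$ (the connected components, restricted to the outer points) and a number $\Phi(a,b)\ge 0$ of internal components (those containing only middle points). The pairs $(a,i)$ with $a$ a diagram on $n$ strands and $i\in\mathbb Z/m$ form a monoid under $(a,i)(b,j)=(ab,\,i+j+\Phi(a,b))$. The *$m$-cyclic planar partition monoid* $m\mathcal{PP}a_n$ is the submonoid of the pairs with $a$ planar, and the *$m$-cyclic Temperley–Lieb monoid* $m\mathcal{TL}_n$ is the submonoid of the pairs with $a$ planar and all blocks of size two. The *through strands* of $(a,i)$ are the blocks of $a$ meeting both the top and the bottom. For $\mathcal S$ one of these monoids, the truncation $\mathcal S^{k\le l}$ is the Rees factor of the submonoid consisting of $1$ and all elements with at most $l$ through strands by the ideal of elements with fewer than $k$ through strands (this ideal is collapsed to a zero element). For a monoid $\mathcal S$ and a field $\mathbb K$, let $\mathbb 1_t$ be the one-dimensional representation on which every element acts by $1$, and $\mathbb 1_b$ the one on which units act by $1$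 and all other elements by $0$. The pair $(\mathcal S,\mathbb K)$ is *$d$-trivial* if every $\mathcal S$-representation over $\mathbb K$ of dimension at most $d$ is isomorphic to a direct sum of copies of $\mathbb 1_t$ and $\mathbb 1_b$; by convention the trivial group and the monoid $\{1,a\}$ with $a^2=a$ are only $(-1)$-trivial. The *representation gap* is $\operatorname{gap}_{\mathbb K}(\mathcal S)=\sup\{g\in\mathbb{Z}_{\ge 0}\mid (\mathcal S,\mathbb K)\text{ is }(g-1)\text{-trivial}\}$ (a maximum whenever it is finite). **Theorem.** Let $m,n,k,l$ be natural numbers with $1\le k\le l<n$, and let $\mathbb K$ be a field with $\operatorname{char}\mathbb K\nmid 2m$. Then $$\operatorname{gap}_{\mathbb K}\bigl(m\mathcal{PP}a_n^{\,k\le l}\bigr)\le \operatorname{gap}_{\mathbb K}\bigl(2m\mathcal{TL}_{2n}^{\,2k\le 2l}\bigr).$$ -/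

import Mathlib

namespace CyclicDiagram

section Gluing

variable {α β γ δ : Type}

/-- The part `α ⊕ β` (upper diagram) of the three layers `α`, `β`, `γ`. -/
def upper : α ⊕ β → α ⊕ (β ⊕ γ) := Sum.map id Sum.inl

/-- The part `β ⊕ γ` (lower diagram) of the three layers `α`, `β`, `γ`. -/
def lower : β ⊕ γ → α ⊕ (β ⊕ γ) := Sum.inr

/-- The outer layers `α ⊕ γ` of the three layers `α`, `β`, `γ`. -/
def outer : α ⊕ γ → α ⊕ (β ⊕ γ) := Sum.map id Sum.inr

/-- Gluing `a` on top of `b` along the middle points `β`: the partition of the three layers of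
points into the connected components of the glued picture. -/
def stack (a : Setoid (α ⊕ β)) (b : Setoid (β ⊕ γ)) : Setoid (α ⊕ (β ⊕ γ)) :=
  a.map upper ⊔ b.map lower

/-- The composite of two partition diagrams (`a` on top of `b`), internal components removed. -/
def comp (a : Setoid (α ⊕ β)) (b : Setoid (β ⊕ γ)) : Setoid (α ⊕ γ) :=
  (stack a b).comap outer

/-- The number of internal components created by gluing `a` on top of `b`: the components that
meet neither the top nor the bottom layer. -/
noncomputable def internal (a : Setoid (α ⊕ β)) (b : Setoid (β ⊕ γ)) : ℕ :=
  {s | s ∈ (stack a b).classes ∧ ∀ x, outer x ∉ s}.ncard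

/-- The identity diagram: each top point is joined to the bottom point below it. -/
def idDiagram (α : Type) : Setoid (α ⊕ α) := Setoid.ker (Sum.elim id id)

/-! Auxiliary facts: associativity of gluing, and the count of internal components. -/

theorem map_le_iff {X Y : Type} {r : Setoid X} {f : X → Y} {s : Setoid Y} :
    r.map f ≤ s ↔ r ≤ s.comap f := by
  constructor
  · intro h x y hxy
    exact h (Relation.EqvGen.rel _ _ ⟨x, y, hxy, rfl, rfl⟩)
  · intro h
    refine Setoid.eqvGen_le ?_
    rintro _ _ ⟨u, v, huv, rfl, rfl⟩
    exact h huv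

theorem map_map' {X Y Z : Type} (r : Setoid X) (f : X → Y) (g : Y → Z) :
    (r.map f).map g = r.map (g ∘ f) :=
  eq_of_forall_ge_iff fun s => by
    rw [map_le_iff, map_le_iff, map_le_iff]; rfl

theorem map_sup' {X Y : Type} (r s : Setoid X) (f : X → Y) :
    (r ⊔ s).map f = r.map f ⊔ s.map f :=
  eq_of_forall_ge_iff fun t => by
    rw [map_le_iff, sup_le_iff, sup_le_iff, map_le_iff, map_le_iff]

theorem map_rel_of_injective {X Y : Type} (r : Setoid X) {f : X → Y}
    (hf : Function.Injective f) {x y : Y} :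
    r.map f x y ↔ (∃ u v, r u v ∧ f u = x ∧ f v = y) ∨ x = y := by
  have h := Setoid.coe_map_of_ker_le r f (fun u v huv => by
    have := hf huv; subst this; exact r.refl' _)
  exact iff_of_eq (congrFun (congrFun h x) y)

/-- Joining `r` with a relation living on a part: explicit description. -/
theorem sup_map_rel {X Y : Type} (r : Setoid X) (s : Setoid Y) (f : Y → X) {x y : X} :
    (r ⊔ s.map f) x y ↔
      r x y ∨ ∃ u v, r x (f u) ∧ (r.comap f ⊔ s) u v ∧ r (f v) y := by
  constructor
  · let E : Setoid X :=
      { r := fun x y => r x y ∨ ∃ u v, r x (f u) ∧ (r.comap f ⊔ s) u v ∧ r (f v) y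
        iseqv := by
          refine ⟨fun x => Or.inl (r.refl' x), ?_, ?_⟩
          · rintro x y (h | ⟨u, v, h1, h2, h3⟩)
            · exact Or.inl (r.symm' h)
            · exact Or.inr ⟨v, u, r.symm' h3, Setoid.symm' _ h2, r.symm' h1⟩
          · rintro x y z (h | ⟨u, v, h1, h2, h3⟩) (h' | ⟨u', v', h1', h2', h3'⟩)
            · exact Or.inl (r.trans' h h')
            · exact Or.inr ⟨u', v', r.trans' h h1', h2', h3'⟩
            · exact Or.inr ⟨u, v, h1, h2, r.trans' h3 h'⟩
            · refine Or.inr ⟨u, v', h1, Setoid.trans' _ h2 (Setoid.trans' _ ?_ h2'), h3'⟩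
              exact (le_sup_left : r.comap f ≤ r.comap f ⊔ s) (r.trans' h3 h1') }
    have hE : r ⊔ s.map f ≤ E := by
      refine sup_le (fun x y h => Or.inl h) (map_le_iff.2 fun u v h => ?_)
      exact Or.inr ⟨u, v, r.refl' _, (le_sup_right : s ≤ r.comap f ⊔ s) h, r.refl' _⟩
    exact fun h => hE h
  · have hr : r ≤ r ⊔ s.map f := le_sup_left
    have hs : r.comap f ⊔ s ≤ (r ⊔ s.map f).comap f :=
      sup_le (fun u v h => hr h) (map_le_iff.1 le_sup_right)
    rintro (h | ⟨u, v, h1, h2, h3⟩)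
    · exact hr h
    · exact Setoid.trans' _ (hr h1) (Setoid.trans' _ (hs h2) (hr h3))

theorem comap_sup_map {X Y : Type} (r : Setoid X) (s : Setoid Y) (f : Y → X) :
    (r ⊔ s.map f).comap f = r.comap f ⊔ s := by
  refine le_antisymm (fun u v h => ?_) ?_
  · rcases (sup_map_rel r s f).1 h with h | ⟨u', v', h1, h2, h3⟩
    · exact (le_sup_left : r.comap f ≤ r.comap f ⊔ s) h
    · have hl : r.comap f ≤ r.comap f ⊔ s := le_sup_left
      exact Setoid.trans' _ (hl h1) (Setoid.trans' _ h2 (hl h3))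
  · exact sup_le (fun u v h => (le_sup_left : r ≤ r ⊔ s.map f) h) (map_le_iff.1 le_sup_right)

theorem comap_map_square {W X Y Z : Type} (r : Setoid X) {i : X → Z} {j : Y → Z} {p : W → X}
    {q : W → Y} (hi : Function.Injective i) (hj : Function.Injective j)
    (hq : Function.Injective q) (hsq : ∀ w, i (p w) = j (q w))
    (hpb : ∀ x y, i x = j y → ∃ w, p w = x ∧ q w = y) :
    (r.map i).comap j = (r.comap p).map q := by
  refine Setoid.ext fun y y' => ?_
  rw [Setoid.comap_rel, map_rel_of_injective r hi, map_rel_of_injective _ hq]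
  constructor
  · rintro (⟨u, v, huv, hu, hv⟩ | h)
    · obtain ⟨w, rfl, rfl⟩ := hpb u y hu
      obtain ⟨w', rfl, rfl⟩ := hpb v y' hv
      exact Or.inl ⟨w, w', huv, rfl, rfl⟩
    · exact Or.inr (hj h)
  · rintro (⟨u, v, huv, rfl, rfl⟩ | h)
    · exact Or.inl ⟨p u, p v, huv, hsq u, hsq v⟩
    · exact Or.inr (congrArg j h)

/-- The classes of `r` that miss the image of `f`. -/
def missed {X Y : Type} (r : Setoid X) (f : Y → X) : Set (Set X) :=
  {s | s ∈ r.classes ∧ ∀ y, f y ∉ s}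

theorem missed_sup_map {X Y : Type} (r : Setoid X) (s : Setoid Y) (f : Y → X) :
    missed (r ⊔ s.map f) f = missed r f := by
  have key : ∀ x : X, (∀ y, ¬ r (f y) x) →
      {z | (r ⊔ s.map f) z x} = {z | r z x} := by
    intro x hx
    ext z
    simp only [Set.mem_ofPred_eq]
    rw [sup_map_rel]
    constructor
    · rintro (h | ⟨u, v, _, _, h⟩)
      · exact h
      · exact absurd h (hx v)
    · exact Or.inl
  ext t
  constructor
  · rintro ⟨⟨x, rfl⟩, h⟩
    have hx : ∀ y, ¬ r (f y) x := fun y hy => h y ((le_sup_left : r ≤ r ⊔ s.map f) hy)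
    refine ⟨⟨x, key x hx⟩, h⟩
  · rintro ⟨⟨x, rfl⟩, h⟩
    exact ⟨⟨x, (key x h).symm⟩, h⟩

theorem ncard_missed_map_square {W X Y Z : Type} (r : Setoid X) {i : X → Z} {j : Y → Z}
    {p : W → X} (q : W → Y) (hi : Function.Injective i)
    (hsq : ∀ w, i (p w) = j (q w))
    (hpb : ∀ x y, i x = j y → ∃ w, p w = x ∧ q w = y)
    (hcov : ∀ z, (∃ x, i x = z) ∨ ∃ y, j y = z) :
    (missed (r.map i) j).ncard = (missed r p).ncard := by
  have hcl : ∀ x : X, {z | r.map i z (i x)} = i '' {x' | r x' x} := by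
    intro x
    ext z
    simp only [Set.mem_ofPred_eq, Set.mem_image]
    rw [map_rel_of_injective r hi]
    constructor
    · rintro (⟨u, v, h, rfl, hv⟩ | rfl)
      · exact ⟨u, hi hv ▸ h, rfl⟩
      · exact ⟨x, r.refl' x, rfl⟩
    · rintro ⟨x', h, rfl⟩
      exact Or.inl ⟨x', x, h, rfl, rfl⟩
  have : missed (r.map i) j = (fun s => i '' s) '' missed r p := by
    ext t
    constructor
    · rintro ⟨⟨z, rfl⟩, h⟩
      rcases hcov z with ⟨x, rfl⟩ | ⟨y, rfl⟩
      · refine ⟨{x' | r x' x}, ⟨⟨x, rfl⟩, fun w hw => h (q w) ?_⟩, (hcl x).symm⟩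
        rw [hcl, ← hsq]
        exact ⟨_, hw, rfl⟩
      · exact absurd (Setoid.refl' (r.map i) (j y)) (h y)
    · rintro ⟨_, ⟨⟨x, rfl⟩, h⟩, rfl⟩
      refine ⟨⟨i x, (hcl x).symm⟩, ?_⟩
      rintro y ⟨x', hx', he⟩
      obtain ⟨w, rfl, rfl⟩ := hpb x' y he
      exact h w hx'
  rw [this]
  exact Set.ncard_image_of_injective _ (Set.image_injective.2 hi)

theorem ncard_missed_comp {X Y Z : Type} [Finite X] (r : Setoid X) (f : Y → X) (g : Z → Y) :
    (missed r (f ∘ g)).ncard = (missed r f).ncard + (missed (r.comap f) g).ncard := by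
  have h1 : missed r (f ∘ g) = missed r f ∪ {s | s ∈ missed r (f ∘ g) ∧ ∃ y, f y ∈ s} := by
    ext s
    constructor
    · intro h
      by_cases hs : ∃ y, f y ∈ s
      · exact Or.inr ⟨h, hs⟩
      · exact Or.inl ⟨h.1, fun y hy => hs ⟨y, hy⟩⟩
    · rintro (h | h)
      · exact ⟨h.1, fun z => h.2 (g z)⟩
      · exact h.1
  rw [h1, Set.ncard_union_eq ?_ (Set.toFinite _) (Set.toFinite _)]
  · congr 1
    have : missed (r.comap f) g =
        (fun s => f ⁻¹' s) '' {s | s ∈ missed r (f ∘ g) ∧ ∃ y, f y ∈ s} := by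
      ext t
      constructor
      · rintro ⟨⟨y, rfl⟩, h⟩
        exact ⟨{x | r x (f y)}, ⟨⟨⟨f y, rfl⟩, h⟩, ⟨y, r.refl' _⟩⟩, rfl⟩
      · rintro ⟨_, ⟨⟨⟨x, rfl⟩, h⟩, ⟨y, hy⟩⟩, rfl⟩
        refine ⟨⟨y, ?_⟩, h⟩
        ext y'
        exact ⟨fun h' => r.trans' h' (r.symm' hy), fun h' => r.trans' h' hy⟩
    rw [this]
    refine (Set.InjOn.ncard_image ?_).symm
    rintro _ ⟨⟨⟨x, rfl⟩, _⟩, ⟨y, hy⟩⟩ _ ⟨⟨⟨x', rfl⟩, _⟩, _⟩ he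
    have hy' : r (f y) x' := by
      have : y ∈ f ⁻¹' {z | r z x'} := (congrArg (fun t => y ∈ t) he).mp hy
      exact this
    have hxx : r x x' := r.trans' (r.symm' hy) hy'
    ext z
    exact ⟨fun h' => r.trans' h' hxx, fun h' => r.trans' h' (r.symm' hxx)⟩
  · rw [Set.disjoint_left]
    rintro s hs ⟨_, y, hy⟩
    exact hs.2 y hy

theorem upper_injective : Function.Injective (upper : α ⊕ β → α ⊕ (β ⊕ γ)) := by
  rintro (x | x) (y | y) h <;> simp_all [upper]

theorem lower_injective : Function.Injective (lower : β ⊕ γ → α ⊕ (β ⊕ γ)) := Sum.inr_injective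

theorem outer_injective : Function.Injective (outer : α ⊕ γ → α ⊕ (β ⊕ γ)) := by
  rintro (x | x) (y | y) h <;> simp_all [outer]

theorem internal_eq_missed (a : Setoid (α ⊕ β)) (b : Setoid (β ⊕ γ)) :
    internal a b = (missed (stack a b) outer).ncard := rfl

/-- Embedding of the layers `α`, `β`, `γ` into four layers. -/
def i123 : α ⊕ (β ⊕ γ) → α ⊕ (β ⊕ (γ ⊕ δ)) := Sum.map id (Sum.map id Sum.inl)
/-- Embedding of the layers `α`, `γ`, `δ` into four layers. -/
def i134 : α ⊕ (γ ⊕ δ) → α ⊕ (β ⊕ (γ ⊕ δ)) := Sum.map id Sum.inr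
/-- Embedding of the layers `α`, `β`, `δ` into four layers. -/
def i124 : α ⊕ (β ⊕ δ) → α ⊕ (β ⊕ (γ ⊕ δ)) := Sum.map id (Sum.map id Sum.inr)
/-- Embedding of the layers `β`, `γ`, `δ` into four layers. -/
def i234 : β ⊕ (γ ⊕ δ) → α ⊕ (β ⊕ (γ ⊕ δ)) := Sum.inr

/-- Three diagrams glued along two middle layers. -/
def stack3 (a : Setoid (α ⊕ β)) (b : Setoid (β ⊕ γ)) (c : Setoid (γ ⊕ δ)) :
    Setoid (α ⊕ (β ⊕ (γ ⊕ δ))) :=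
  a.map upper ⊔ (b.map upper ⊔ c.map lower).map i234

theorem stack3_left (a : Setoid (α ⊕ β)) (b : Setoid (β ⊕ γ)) (c : Setoid (γ ⊕ δ)) :
    stack3 a b c = (stack a b).map i123 ⊔ (c.map lower).map i134 := by
  unfold stack3 stack
  rw [map_sup', map_sup', map_map', map_map', map_map', map_map', map_map', ← sup_assoc]
  congr 1
  congr 1
  · congr 1; funext x; rcases x with x | x <;> rfl

theorem stack3_right (a : Setoid (α ⊕ β)) (b : Setoid (β ⊕ γ)) (c : Setoid (γ ⊕ δ)) :
    stack3 a b c = (stack b c).map i234 ⊔ (a.map upper).map i124 := by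
  unfold stack3 stack
  rw [sup_comm, map_map' a]
  congr 2
  funext x; rcases x with x | x <;> rfl

theorem sq_left (w : α ⊕ γ) : (i123 (outer w) : α ⊕ (β ⊕ (γ ⊕ δ))) = i134 (upper w) := by
  rcases w with w | w <;> rfl

theorem sq_right (w : β ⊕ δ) : (i234 (outer w) : α ⊕ (β ⊕ (γ ⊕ δ))) = i124 (lower w) := by
  rcases w with w | w <;> rfl

theorem pb_left (x : α ⊕ (β ⊕ γ)) (y : α ⊕ (γ ⊕ δ)) (h : i123 x = i134 y) :
    ∃ w, outer w = x ∧ upper w = y := by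
  rcases x with x | x | x <;> rcases y with y | y | y <;> simp [i123, i134] at h
  · exact ⟨Sum.inl x, rfl, by subst h; rfl⟩
  · exact ⟨Sum.inr x, rfl, by subst h; rfl⟩

theorem pb_right (x : β ⊕ (γ ⊕ δ)) (y : α ⊕ (β ⊕ δ)) (h : i234 x = i124 y) :
    ∃ w, outer w = x ∧ lower w = y := by
  rcases x with x | x | x <;> rcases y with y | y | y <;> simp [i234, i124] at h
  · exact ⟨Sum.inl x, rfl, by subst h; rfl⟩
  · exact ⟨Sum.inr x, rfl, by subst h; rfl⟩

theorem i123_injective : Function.Injective (i123 : _ → α ⊕ (β ⊕ (γ ⊕ δ))) := by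
  rintro (x | x | x) (y | y | y) h <;> simp_all [i123]

theorem i134_injective : Function.Injective (i134 : _ → α ⊕ (β ⊕ (γ ⊕ δ))) := by
  rintro (x | x | x) (y | y | y) h <;> simp_all [i134]

theorem i124_injective : Function.Injective (i124 : _ → α ⊕ (β ⊕ (γ ⊕ δ))) := by
  rintro (x | x | x) (y | y | y) h <;> simp_all [i124]

theorem i234_injective : Function.Injective (i234 : _ → α ⊕ (β ⊕ (γ ⊕ δ))) := Sum.inr_injective

theorem cov_left (z : α ⊕ (β ⊕ (γ ⊕ δ))) : (∃ x, i123 x = z) ∨ ∃ y, i134 y = z := by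
  rcases z with z | z | z | z
  · exact Or.inl ⟨Sum.inl z, rfl⟩
  · exact Or.inl ⟨Sum.inr (Sum.inl z), rfl⟩
  · exact Or.inl ⟨Sum.inr (Sum.inr z), rfl⟩
  · exact Or.inr ⟨Sum.inr (Sum.inr z), rfl⟩

theorem cov_right (z : α ⊕ (β ⊕ (γ ⊕ δ))) : (∃ x, i234 x = z) ∨ ∃ y, i124 y = z := by
  rcases z with z | z
  · exact Or.inr ⟨Sum.inl z, rfl⟩
  · exact Or.inl ⟨z, rfl⟩

theorem comap_stack3_left (a : Setoid (α ⊕ β)) (b : Setoid (β ⊕ γ)) (c : Setoid (γ ⊕ δ)) :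
    (stack3 a b c).comap i134 = stack (comp a b) c := by
  rw [stack3_left, comap_sup_map, comap_map_square (stack a b) i123_injective i134_injective
    upper_injective sq_left pb_left]
  rfl

theorem comap_stack3_right (a : Setoid (α ⊕ β)) (b : Setoid (β ⊕ γ)) (c : Setoid (γ ⊕ δ)) :
    (stack3 a b c).comap i124 = stack a (comp b c) := by
  rw [stack3_right, comap_sup_map, comap_map_square (stack b c) i234_injective i124_injective
    lower_injective sq_right pb_right, sup_comm]
  rfl

theorem outer_left : (i134 ∘ outer : α ⊕ δ → α ⊕ (β ⊕ (γ ⊕ δ))) = i124 ∘ outer := by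
  funext x; rcases x with x | x <;> rfl

theorem comp_assoc (a : Setoid (α ⊕ β)) (b : Setoid (β ⊕ γ)) (c : Setoid (γ ⊕ δ)) :
    comp (comp a b) c = comp a (comp b c) := by
  change (stack (comp a b) c).comap outer = (stack a (comp b c)).comap outer
  rw [← comap_stack3_left, ← comap_stack3_right]
  change (stack3 a b c).comap (i134 ∘ outer) = (stack3 a b c).comap (i124 ∘ outer)
  rw [outer_left]

theorem internal_assoc [Finite α] [Finite β] [Finite γ] [Finite δ]
    (a : Setoid (α ⊕ β)) (b : Setoid (β ⊕ γ)) (c : Setoid (γ ⊕ δ)) :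
    internal a b + internal (comp a b) c = internal b c + internal a (comp b c) := by
  have hl : (missed (stack3 a b c) (i134 ∘ outer)).ncard =
      internal a b + internal (comp a b) c := by
    rw [ncard_missed_comp, comap_stack3_left, internal_eq_missed (comp a b), stack3_left,
      missed_sup_map, ncard_missed_map_square (stack a b) upper i123_injective sq_left pb_left
        cov_left]
    rfl
  have hr : (missed (stack3 a b c) (i124 ∘ outer)).ncard =
      internal b c + internal a (comp b c) := by
    rw [ncard_missed_comp, comap_stack3_right, internal_eq_missed a, stack3_right,
      missed_sup_map, ncard_missed_map_square (stack b c) lower i234_injective sq_right pb_right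
        cov_right]
    rfl
  rw [← hl, ← hr, outer_left]

theorem stack_upper (a : Setoid (α ⊕ β)) (b : Setoid (β ⊕ γ)) {x y : α ⊕ β} (h : a x y) :
    stack a b (upper x) (upper y) :=
  (le_sup_left : a.map upper ≤ stack a b) (Relation.EqvGen.rel _ _ ⟨x, y, h, rfl, rfl⟩)

theorem stack_lower (a : Setoid (α ⊕ β)) (b : Setoid (β ⊕ γ)) {x y : β ⊕ γ} (h : b x y) :
    stack a b (lower x) (lower y) :=
  (le_sup_right : b.map lower ≤ stack a b) (Relation.EqvGen.rel _ _ ⟨x, y, h, rfl, rfl⟩)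

theorem stack_le {a : Setoid (α ⊕ β)} {b : Setoid (β ⊕ γ)} {r : Setoid (α ⊕ (β ⊕ γ))}
    (ha : a ≤ r.comap upper) (hb : b ≤ r.comap lower) : stack a b ≤ r :=
  sup_le (map_le_iff.2 ha) (map_le_iff.2 hb)

theorem internal_eq_zero (a : Setoid (α ⊕ β)) (b : Setoid (β ⊕ γ))
    (h : ∀ j : β, ∃ x, stack a b (outer x) (Sum.inr (Sum.inl j))) : internal a b = 0 := by
  have : {s | s ∈ (stack a b).classes ∧ ∀ x, outer x ∉ s} = ∅ := by
    rw [Set.eq_empty_iff_forall_notMem]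
    rintro _ ⟨⟨x, rfl⟩, hs⟩
    rcases x with x | x | x
    · exact hs (Sum.inl x) (Setoid.refl' (stack a b) _)
    · obtain ⟨y, hy⟩ := h x
      exact hs y hy
    · exact hs (Sum.inr x) (Setoid.refl' (stack a b) _)
  rw [internal, this, Set.ncard_empty]

theorem id_stack_rel (a : Setoid (α ⊕ β)) (i : α) :
    stack (idDiagram α) a (Sum.inl i) (Sum.inr (Sum.inl i)) :=
  stack_upper (idDiagram α) a (x := Sum.inl i) (y := Sum.inr i) rfl

theorem stack_id_rel (a : Setoid (α ⊕ β)) (i : β) :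
    stack a (idDiagram β) (Sum.inr (Sum.inr i)) (Sum.inr (Sum.inl i)) :=
  stack_lower a (idDiagram β) (x := Sum.inr i) (y := Sum.inl i) rfl

theorem id_comp (a : Setoid (α ⊕ β)) : comp (idDiagram α) a = a := by
  refine le_antisymm ?_ ?_
  · have : stack (idDiagram α) a ≤ a.comap (Sum.elim Sum.inl id) := by
      refine stack_le ?_ (fun x y h => h)
      rintro (x | x) (y | y) h <;>
        (have h' : x = y := h; subst h'; exact a.refl' _)
    rintro (x | x) (y | y) h <;> exact this h
  · rintro (x | x) (y | y) h
    · exact Setoid.trans' (stack (idDiagram α) a) (id_stack_rel a x)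
        (Setoid.trans' (stack (idDiagram α) a) (stack_lower (idDiagram α) a h) (Setoid.symm' (stack (idDiagram α) a) (id_stack_rel a y)))
    · exact Setoid.trans' (stack (idDiagram α) a) (id_stack_rel a x) (stack_lower (idDiagram α) a h)
    · exact Setoid.trans' (stack (idDiagram α) a) (stack_lower (idDiagram α) a h) (Setoid.symm' (stack (idDiagram α) a) (id_stack_rel a y))
    · exact stack_lower (idDiagram α) a h

theorem comp_id (a : Setoid (α ⊕ β)) : comp a (idDiagram β) = a := by
  refine le_antisymm ?_ ?_
  · have : stack a (idDiagram β) ≤ a.comap (Sum.elim Sum.inl (Sum.elim Sum.inr Sum.inr)) := by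
      refine stack_le ?_ ?_
      · rintro (x | x) (y | y) h <;> exact h
      · rintro (x | x) (y | y) h <;>
          (have h' : x = y := h; subst h'; exact a.refl' _)
    rintro (x | x) (y | y) h <;> exact this h
  · rintro (x | x) (y | y) h
    · exact stack_upper a (idDiagram β) h
    · exact Setoid.trans' (stack a (idDiagram β)) (stack_upper a (idDiagram β) h) (Setoid.symm' (stack a (idDiagram β)) (stack_id_rel a y))
    · exact Setoid.trans' (stack a (idDiagram β)) (stack_id_rel a x) (stack_upper a (idDiagram β) h)
    · exact Setoid.trans' (stack a (idDiagram β)) (stack_id_rel a x) (Setoid.trans' (stack a (idDiagram β))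
        (stack_upper a (idDiagram β) h) (Setoid.symm' (stack a (idDiagram β)) (stack_id_rel a y)))

theorem internal_id_left (a : Setoid (α ⊕ β)) : internal (idDiagram α) a = 0 :=
  internal_eq_zero _ _ fun j => ⟨Sum.inl j, id_stack_rel a j⟩

theorem internal_id_right (a : Setoid (α ⊕ β)) : internal a (idDiagram β) = 0 :=
  internal_eq_zero _ _ fun j => ⟨Sum.inr j, stack_id_rel a j⟩

end Gluing

/-! ### Planar diagrams -/

section Planar

variable {n : ℕ}

/-- Position of the `n` top points (`Sum.inl`) and `n` bottom points (`Sum.inr`) on the boundary of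
the rectangle, read along the top from left to right, then along the bottom from right to left. -/
def pos : Fin n ⊕ Fin n → ℕ
  | Sum.inl i => i
  | Sum.inr i => 2 * n - 1 - i

/-- A partition of the boundary points can be drawn in the rectangle without crossings: no two
different blocks interleave on the boundary. -/
def IsPlanar (r : Setoid (Fin n ⊕ Fin n)) : Prop :=
  ∀ w x y z, pos w < pos x → pos x < pos y → pos y < pos z → r w y → r x z → r w x

/-- A partition of the boundary points into blocks of size two. -/
def IsMatching (r : Setoid (Fin n ⊕ Fin n)) : Prop :=
  ∀ s ∈ r.classes, s.ncard = 2

/-- The number of through strands: blocks meeting both the top and the bottom. -/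
noncomputable def throughStrands (r : Setoid (Fin n ⊕ Fin n)) : ℕ :=
  {s | s ∈ r.classes ∧ (∃ i, Sum.inl i ∈ s) ∧ ∃ j, Sum.inr j ∈ s}.ncard

/-! Auxiliary facts: these notions are compatible with gluing. -/

theorem pos_injective : Function.Injective (pos : Fin n ⊕ Fin n → ℕ) := by
  rintro (x | x) (y | y) h <;> simp only [pos] at h
  · exact congrArg _ (Fin.ext h)
  · omega
  · omega
  · exact congrArg _ (Fin.ext (by omega))

/-- Order indicator inside one layer. -/
def ordInd (x y : Fin n ⊕ Fin n) : ZMod 2 :=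
  match x, y with
  | Sum.inl i, Sum.inl j => if i < j then 1 else 0
  | Sum.inr i, Sum.inr j => if i < j then 1 else 0
  | _, _ => 0

/-- Order indicator inside one of three layers. -/
def ordInd3 (x y : Fin n ⊕ (Fin n ⊕ Fin n)) : ZMod 2 :=
  match x, y with
  | Sum.inl i, Sum.inl j => if i < j then 1 else 0
  | Sum.inr i, Sum.inr j => ordInd i j
  | _, _ => 0

/-- Indicator of the bottom layer. -/
def botInd : Fin n ⊕ Fin n → ZMod 2
  | Sum.inl _ => 0
  | Sum.inr _ => 1

theorem pos_ind {x y : Fin n ⊕ Fin n} (h : x ≠ y) :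
    (if pos x < pos y then 1 else 0 : ZMod 2) = ordInd x y + botInd y := by
  rcases x with x | x <;> rcases y with y | y
  · simp [pos, ordInd, botInd]
  · have : (x : ℕ) < 2 * n - 1 - y := by omega
    simp [pos, ordInd, botInd, this]
  · have : ¬ (2 * n - 1 - x < (y : ℕ)) := by omega
    simp [pos, ordInd, botInd, this]
  · have hxy : (x : ℕ) ≠ y := fun h' => h (congrArg _ (Fin.ext h'))
    by_cases hlt : x < y
    · have h1 : (x : ℕ) < y := hlt
      have : ¬ (2 * n - 1 - (x : ℕ) < 2 * n - 1 - y) := by omega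
      simp only [pos, ordInd, botInd, this, hlt, if_true, if_false]
      rfl
    · have h1 : ¬ (x : ℕ) < y := hlt
      have : 2 * n - 1 - (x : ℕ) < 2 * n - 1 - y := by omega
      simp [pos, ordInd, botInd, this, hlt]

theorem cross_eq {x x' y y' : Fin n ⊕ Fin n} (h1 : x ≠ y) (h2 : x' ≠ y) (h3 : x ≠ y')
    (h4 : x' ≠ y') :
    ordInd x y + ordInd x' y + ordInd x y' + ordInd x' y' =
      (if pos x < pos y then 1 else 0 : ZMod 2) + (if pos x' < pos y then 1 else 0) +
        (if pos x < pos y' then 1 else 0) + (if pos x' < pos y' then 1 else 0) := by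
  rw [pos_ind h1, pos_ind h2, pos_ind h3, pos_ind h4]
  have h : ∀ a b c d e f : ZMod 2,
      a + b + c + d = (a + e) + (b + e) + (c + f) + (d + f) := by decide
  exact h _ _ _ _ _ _

theorem IsPlanar.even {r : Setoid (Fin n ⊕ Fin n)} (hr : IsPlanar r) {x x' y y' : Fin n ⊕ Fin n}
    (hx : r x x') (hy : r y y') (hxy : ¬ r x y) :
    ordInd x y + ordInd x' y + ordInd x y' + ordInd x' y' = 0 := by
  have hx' := r.symm' hx
  have hy' := r.symm' hy
  have n1 : ¬ r x y' := fun h => hxy (r.trans' h hy')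
  have n2 : ¬ r x' y := fun h => hxy (r.trans' hx h)
  have n3 : ¬ r x' y' := fun h => n1 (r.trans' hx h)
  have ne : ∀ {u v}, ¬ r u v → u ≠ v := fun h e => h (e ▸ r.refl' _)
  have pne : ∀ {u v}, ¬ r u v → pos u ≠ pos v := fun h e => ne h (pos_injective e)
  rw [cross_eq (ne hxy) (ne n2) (ne n1) (ne n3)]
  have m : ∀ {u v}, ¬ r u v → ¬ r v u := fun h h' => h (r.symm' h')
  have a1 : ¬ (pos x < pos y ∧ pos y < pos x' ∧ pos x' < pos y') :=
    fun ⟨p, q, s⟩ => hxy (hr x y x' y' p q s hx hy)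
  have a2 : ¬ (pos x < pos y' ∧ pos y' < pos x' ∧ pos x' < pos y) :=
    fun ⟨p, q, s⟩ => n1 (hr x y' x' y p q s hx hy')
  have a3 : ¬ (pos x' < pos y ∧ pos y < pos x ∧ pos x < pos y') :=
    fun ⟨p, q, s⟩ => n2 (hr x' y x y' p q s hx' hy)
  have a4 : ¬ (pos x' < pos y' ∧ pos y' < pos x ∧ pos x < pos y) :=
    fun ⟨p, q, s⟩ => n3 (hr x' y' x y p q s hx' hy')
  have b1 : ¬ (pos y < pos x ∧ pos x < pos y' ∧ pos y' < pos x') :=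
    fun ⟨p, q, s⟩ => m hxy (hr y x y' x' p q s hy hx)
  have b2 : ¬ (pos y < pos x' ∧ pos x' < pos y' ∧ pos y' < pos x) :=
    fun ⟨p, q, s⟩ => m n2 (hr y x' y' x p q s hy hx')
  have b3 : ¬ (pos y' < pos x ∧ pos x < pos y ∧ pos y < pos x') :=
    fun ⟨p, q, s⟩ => m n1 (hr y' x y x' p q s hy' hx)
  have b4 : ¬ (pos y' < pos x' ∧ pos x' < pos y ∧ pos y < pos x) :=
    fun ⟨p, q, s⟩ => m n3 (hr y' x' y x p q s hy' hx')
  have c1 := pne hxy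
  have c2 := pne n1
  have c3 := pne n2
  have c4 := pne n3
  have e1 : (1 + 1 : ZMod 2) = 0 := rfl
  split_ifs <;> first | rfl | (exfalso; omega)

theorem ordInd3_upper (x y : Fin n ⊕ Fin n) : ordInd3 (upper x) (upper y) = ordInd x y := by
  rcases x with x | x <;> rcases y with y | y <;> rfl

theorem ordInd3_lower (x y : Fin n ⊕ Fin n) : ordInd3 (lower x) (lower y) = ordInd x y := by
  rcases x with x | x <;> rcases y with y | y <;> rfl

theorem ordInd3_outer (x y : Fin n ⊕ Fin n) : ordInd3 (outer x) (outer y) = ordInd x y := by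
  rcases x with x | x <;> rcases y with y | y <;> rfl

theorem exists_potential {a b : Setoid (Fin n ⊕ Fin n)} (ha : IsPlanar a) (hb : IsPlanar b)
    {y y' : Fin n ⊕ (Fin n ⊕ Fin n)} (h : stack a b y y') :
    ∃ F G : Fin n ⊕ (Fin n ⊕ Fin n) → ZMod 2,
      (∀ x x', a x x' → ¬ stack a b (upper x) y → F (upper x) = F (upper x')) ∧
      (∀ x x', b x x' → ¬ stack a b (lower x) y → G (lower x) = G (lower x')) ∧
      (∀ x, F x + G x = ordInd3 x y + ordInd3 x y') ∧
      (∀ i, F (Sum.inr (Sum.inr i)) = 0) ∧ ∀ i, G (Sum.inl i) = 0 := by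
  have two : ∀ u v : ZMod 2, u = v → u + v = 0 := by decide
  have two' : ∀ u v w z : ZMod 2, u + w + v + z = 0 → u + v = w + z := by decide
  let E : Setoid (Fin n ⊕ (Fin n ⊕ Fin n)) :=
    { r := fun y y' => stack a b y y' ∧ ∃ F G : Fin n ⊕ (Fin n ⊕ Fin n) → ZMod 2,
        (∀ x x', a x x' → ¬ stack a b (upper x) y → F (upper x) = F (upper x')) ∧
        (∀ x x', b x x' → ¬ stack a b (lower x) y → G (lower x) = G (lower x')) ∧
        (∀ x, F x + G x = ordInd3 x y + ordInd3 x y') ∧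
        (∀ i, F (Sum.inr (Sum.inr i)) = 0) ∧ ∀ i, G (Sum.inl i) = 0
      iseqv := by
        refine ⟨fun y => ⟨Setoid.refl' _ _, fun _ => 0, fun _ => 0, ?_⟩, ?_, ?_⟩
        · exact ⟨fun _ _ _ _ => rfl, fun _ _ _ _ => rfl, fun x => (two _ _ rfl).symm,
            fun _ => rfl, fun _ => rfl⟩
        · rintro y y' ⟨h, F, G, h1, h2, h3, h4, h5⟩
          refine ⟨Setoid.symm' _ h, F, G, fun x x' hx hn => h1 x x' hx fun hs => hn ?_,
            fun x x' hx hn => h2 x x' hx fun hs => hn ?_, fun x => by rw [h3, add_comm], h4, h5⟩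
          · exact Setoid.trans' _ hs h
          · exact Setoid.trans' _ hs h
        · rintro y y' y'' ⟨h, F, G, h1, h2, h3, h4, h5⟩ ⟨h', F', G', h1', h2', h3', h4', h5'⟩
          refine ⟨Setoid.trans' _ h h', fun x => F x + F' x, fun x => G x + G' x, ?_, ?_, ?_, ?_, ?_⟩
          · intro x x' hx hn
            exact congrArg₂ (· + ·) (h1 x x' hx hn)
              (h1' x x' hx fun hs => hn (Setoid.trans' _ hs (Setoid.symm' _ h)))
          · intro x x' hx hn
            exact congrArg₂ (· + ·) (h2 x x' hx hn)
              (h2' x x' hx fun hs => hn (Setoid.trans' _ hs (Setoid.symm' _ h)))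
          · intro x
            have k : ∀ f g f' g' p q r : ZMod 2, f + g = p + q → f' + g' = q + r →
                f + f' + (g + g') = p + r := by decide
            exact k _ _ _ _ _ _ _ (h3 x) (h3' x)
          · intro i; change F _ + F' _ = 0; rw [h4, h4', add_zero]
          · intro i; change G _ + G' _ = 0; rw [h5, h5', add_zero] }
  suffices hE : stack a b ≤ E from (hE h).2
  refine stack_le (fun u v huv => ?_) (fun u v huv => ?_)
  · refine ⟨stack_upper a b huv, fun x => ordInd3 x (upper u) + ordInd3 x (upper v), fun _ => 0,
      ?_, fun _ _ _ _ => rfl, fun x => add_zero _, ?_, fun _ => rfl⟩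
    · intro x x' hx hn
      simp only [ordInd3_upper]
      exact two' _ _ _ _ (ha.even hx huv fun hs => hn (stack_upper a b hs))
    · intro i
      rcases u with u | u <;> rcases v with v | v <;> rfl
  · refine ⟨stack_lower a b huv, fun _ => 0, fun x => ordInd3 x (lower u) + ordInd3 x (lower v),
      fun _ _ _ _ => rfl, ?_, fun x => zero_add _, fun _ => rfl, ?_⟩
    · intro x x' hx hn
      simp only [ordInd3_lower]
      exact two' _ _ _ _ (hb.even hx huv fun hs => hn (stack_lower a b hs))
    · intro i
      rcases u with u | u <;> rcases v with v | v <;> rfl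

theorem IsPlanar.comp {a b : Setoid (Fin n ⊕ Fin n)} (ha : IsPlanar a) (hb : IsPlanar b) :
    IsPlanar (comp a b) := by
  intro w x y z hwx hxy hyz hwy hxz
  by_contra hn
  obtain ⟨F, G, h1, h2, h3, h4, h5⟩ := exists_potential ha hb (show stack a b _ _ from hxz)
  let P : Fin n ⊕ (Fin n ⊕ Fin n) → ZMod 2 := fun p =>
    match p with
    | Sum.inl i => F (Sum.inl i)
    | Sum.inr (Sum.inl i) => F (Sum.inr (Sum.inl i))
    | Sum.inr (Sum.inr i) => G (Sum.inr (Sum.inr i))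
  have hmid : ∀ i, F (Sum.inr (Sum.inl i)) = G (Sum.inr (Sum.inl i)) := by
    intro i
    have h0 := h3 (Sum.inr (Sum.inl i))
    have k : ∀ f g : ZMod 2, f + g = 0 + 0 → f = g := by decide
    apply k
    rw [h0]
    rcases x with x | x <;> rcases z with z | z <;> rfl
  have hPu : ∀ q : Fin n ⊕ Fin n, P (upper q) = F (upper q) := by
    rintro (q | q) <;> rfl
  have hPl : ∀ q : Fin n ⊕ Fin n, P (lower q) = G (lower q) := by
    rintro (q | q)
    · exact hmid q
    · rfl
  have hPo : ∀ q : Fin n ⊕ Fin n, P (outer q) = ordInd q x + ordInd q z := by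
    intro q
    rw [← ordInd3_outer, ← ordInd3_outer, ← h3]
    rcases q with q | q
    · change F _ = F _ + G (Sum.inl q)
      rw [h5, add_zero]; rfl
    · change G _ = F (Sum.inr (Sum.inr q)) + G _
      rw [h4, zero_add]; rfl
  let E : Setoid (Fin n ⊕ (Fin n ⊕ Fin n)) :=
    { r := fun p p' => stack a b p p' ∧ (¬ stack a b p (outer x) → P p = P p')
      iseqv := by
        refine ⟨fun p => ⟨Setoid.refl' _ _, fun _ => rfl⟩, ?_, ?_⟩
        · rintro p p' ⟨h, h'⟩
          exact ⟨Setoid.symm' _ h, fun hq => (h' fun hs =>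
            hq (Setoid.trans' _ (Setoid.symm' _ h) hs)).symm⟩
        · rintro p p' p'' ⟨h, h'⟩ ⟨k, k'⟩
          exact ⟨Setoid.trans' _ h k, fun hq => (h' hq).trans (k' fun hs =>
            hq (Setoid.trans' _ h hs))⟩ }
  have hE : stack a b ≤ E := by
    refine stack_le (fun u v huv => ⟨stack_upper a b huv, fun hq => ?_⟩)
      (fun u v huv => ⟨stack_lower a b huv, fun hq => ?_⟩)
    · rw [hPu, hPu]; exact h1 u v huv hq
    · rw [hPl, hPl]; exact h2 u v huv hq
  have hfin := (hE (show stack a b _ _ from hwy)).2 hn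
  rw [hPo, hPo] at hfin
  have ne : ∀ {u v : Fin n ⊕ Fin n}, pos u ≠ pos v → u ≠ v := fun h e => h (congrArg pos e)
  have key := cross_eq (x := w) (x' := y) (y := x) (y' := z) (ne (by omega)) (ne (by omega))
    (ne (by omega)) (ne (by omega))
  rw [if_pos hwx, if_neg (by omega), if_pos (by omega), if_pos hyz] at key
  have k : ∀ p q r s : ZMod 2, p + q = r + s → p + r + q + s ≠ 1 + 0 + 1 + 1 := by decide
  exact k _ _ _ _ hfin key

theorem IsMatching.exists_partner {r : Setoid (Fin n ⊕ Fin n)} (hr : IsMatching r) :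
    ∃ σ : Fin n ⊕ Fin n → Fin n ⊕ Fin n, (∀ x, σ x ≠ x) ∧ (∀ x, σ (σ x) = x) ∧
      ∀ x y, r x y ↔ y = x ∨ y = σ x := by
  have h : ∀ x, ∃ y, y ≠ x ∧ ∀ z, r x z ↔ z = x ∨ z = y := by
    intro x
    obtain ⟨u, v, huv, hs⟩ := Set.ncard_eq_two.1 (hr {z | r z x} ⟨x, rfl⟩)
    have hm : ∀ z, r x z ↔ z = u ∨ z = v := by
      intro z
      have : z ∈ ({z | r z x} : Set _) ↔ z = u ∨ z = v := by rw [hs]; rfl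
      exact ⟨fun h => this.1 (r.symm' h), fun h => r.symm' (this.2 h)⟩
    rcases (hm x).1 (r.refl' x) with e | e
    · exact ⟨v, by rw [e]; exact huv.symm, fun z => by rw [hm z, e]⟩
    · exact ⟨u, by rw [e]; exact huv, fun z => by rw [hm z, e, or_comm]⟩
  choose σ h1 h2 using h
  refine ⟨σ, h1, fun x => ?_, h2⟩
  have hx : r x (σ x) := (h2 x _).2 (Or.inr rfl)
  rcases (h2 (σ x) x).1 (r.symm' hx) with e | e
  · exact absurd e.symm (h1 x)
  · exact e.symm

/-- Following a strand through the glued picture: `(p, true)` continues in the upper diagram,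
`(p, false)` in the lower one. -/
inductive Walk (σ τ : Fin n ⊕ Fin n → Fin n ⊕ Fin n) :
    (Fin n ⊕ (Fin n ⊕ Fin n)) × Bool → (Fin n ⊕ (Fin n ⊕ Fin n)) × Bool → Prop
  | up (x : Fin n ⊕ Fin n) : Walk σ τ (upper x, true) (upper (σ x), false)
  | down (x : Fin n ⊕ Fin n) : Walk σ τ (lower x, false) (lower (τ x), true)

/-- The side from which an outer point enters the glued picture. -/
def side : Fin n ⊕ Fin n → Bool
  | Sum.inl _ => true
  | Sum.inr _ => false

theorem Walk.source {σ τ : Fin n ⊕ Fin n → Fin n ⊕ Fin n} {z p}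
    (h : Walk σ τ (outer z, !(side z)) p) : False := by
  generalize hq : ((outer z, !(side z)) : (Fin n ⊕ (Fin n ⊕ Fin n)) × Bool) = q at h
  rcases h with x | x <;> rcases z with z | z <;> rcases x with x | x <;>
    simp [side, upper, lower, outer] at hq

theorem Walk.target {σ τ : Fin n ⊕ Fin n → Fin n ⊕ Fin n} {z : Fin n ⊕ Fin n} {p}
    (h : Walk σ τ p (outer z, side z)) : False := by
  generalize hq : ((outer z, side z) : (Fin n ⊕ (Fin n ⊕ Fin n)) × Bool) = q at h
  rcases h with x | x
  · rcases z with z | z <;> rcases hx : σ x with y | y <;>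
      simp [side, upper, outer, hx] at hq
  · rcases z with z | z <;> rcases hx : τ x with y | y <;>
      simp [side, lower, outer, hx] at hq

theorem Walk.rightUnique (σ τ : Fin n ⊕ Fin n → Fin n ⊕ Fin n) :
    Relator.RightUnique (Walk σ τ) := by
  intro p q q' h h'
  rcases h with x | x
  · generalize hp : ((upper x, true) : (Fin n ⊕ (Fin n ⊕ Fin n)) × Bool) = p at h'
    rcases h' with y | y
    · rw [upper_injective (congrArg Prod.fst hp)]
    · exact absurd (congrArg Prod.snd hp) (by simp)
  · generalize hp : ((lower x, false) : (Fin n ⊕ (Fin n ⊕ Fin n)) × Bool) = p at h'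
    rcases h' with y | y
    · exact absurd (congrArg Prod.snd hp) (by simp)
    · rw [lower_injective (congrArg Prod.fst hp)]

theorem comp_matching_unique {a b : Setoid (Fin n ⊕ Fin n)} (ha : IsMatching a)
    (hb : IsMatching b) {z z₁ z₂ : Fin n ⊕ Fin n} (h₁ : comp a b z z₁) (h₂ : comp a b z z₂)
    (n₁ : z₁ ≠ z) (n₂ : z₂ ≠ z) : z₁ = z₂ := by
  obtain ⟨σ, -, hσ, hσr⟩ := ha.exists_partner
  obtain ⟨τ, -, hτ, hτr⟩ := hb.exists_partner
  let W : Set (Fin n ⊕ (Fin n ⊕ Fin n)) :=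
    {p | ∃ s, Relation.ReflTransGen (Walk σ τ) (outer z, side z) (p, s)}
  have hWu : ∀ x, upper x ∈ W → upper (σ x) ∈ W := by
    rintro x ⟨s, hs⟩
    cases s
    · rcases Relation.ReflTransGen.cases_tail hs with h | ⟨c, hc, hcx⟩
      · exfalso
        rcases z with z | z <;> rcases x with x | x <;> simp [side, upper, outer] at h
      · generalize hq : ((upper x, false) : (Fin n ⊕ (Fin n ⊕ Fin n)) × Bool) = q at hcx
        rcases hcx with x' | x'
        · have := upper_injective (congrArg Prod.fst hq)
          rw [this, hσ]
          exact ⟨_, hc⟩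
        · exact absurd (congrArg Prod.snd hq) (by simp)
    · exact ⟨_, hs.tail (Walk.up x)⟩
  have hWl : ∀ x, lower x ∈ W → lower (τ x) ∈ W := by
    rintro x ⟨s, hs⟩
    cases s
    · exact ⟨_, hs.tail (Walk.down x)⟩
    · rcases Relation.ReflTransGen.cases_tail hs with h | ⟨c, hc, hcx⟩
      · exfalso
        rcases z with z | z <;> rcases x with x | x <;> simp [side, lower, outer] at h
      · generalize hq : ((lower x, true) : (Fin n ⊕ (Fin n ⊕ Fin n)) × Bool) = q at hcx
        rcases hcx with x' | x'
        · exact absurd (congrArg Prod.snd hq) (by simp)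
        · have := lower_injective (congrArg Prod.fst hq)
          rw [this, hτ]
          exact ⟨_, hc⟩
  have hle : stack a b ≤ Setoid.ker (fun p => p ∈ W) := by
    refine stack_le (fun x y h => ?_) (fun x y h => ?_)
    · refine propext ?_
      rcases (hσr x y).1 h with rfl | rfl
      · exact Iff.rfl
      · exact ⟨hWu x, fun h => by simpa [hσ] using hWu _ h⟩
    · refine propext ?_
      rcases (hτr x y).1 h with rfl | rfl
      · exact Iff.rfl
      · exact ⟨hWl x, fun h => by simpa [hτ] using hWl _ h⟩
  have hz : outer z ∈ W := ⟨_, Relation.ReflTransGen.refl⟩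
  have reach : ∀ y, comp a b z y → y ≠ z →
      Relation.ReflTransGen (Walk σ τ) (outer z, side z) (outer y, !(side y)) := by
    intro y hy hne
    have hyW : outer y ∈ W := (iff_of_eq (hle (show stack a b _ _ from hy))).1 hz
    obtain ⟨s, hs⟩ := hyW
    rcases eq_or_ne s (side y) with rfl | hsy
    · exfalso
      rcases Relation.ReflTransGen.cases_tail hs with h | ⟨c, hc, hcx⟩
      · exact hne (outer_injective (congrArg Prod.fst h))
      · exact hcx.target
    · have : s = !(side y) := by cases s <;> cases h : side y <;> simp_all
      exact this ▸ hs
  have fin : ∀ y y', Relation.ReflTransGen (Walk σ τ) (outer y, !(side y)) (outer y', !(side y')) →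
      y = y' := by
    intro y y' h
    rcases Relation.ReflTransGen.cases_head h with h | ⟨c, hc, -⟩
    · exact outer_injective (congrArg Prod.fst h)
    · exact hc.source.elim
  rcases Relation.ReflTransGen.total_of_right_unique (Walk.rightUnique σ τ)
    (reach z₁ h₁ n₁) (reach z₂ h₂ n₂) with h | h
  · exact fin _ _ h
  · exact (fin _ _ h).symm

theorem IsMatching.sum_eq_zero {r : Setoid (Fin n ⊕ Fin n)} (hr : IsMatching r)
    (χ : Fin n ⊕ Fin n → ZMod 2) (hχ : ∀ x y, r x y → χ x = χ y) : ∑ x, χ x = 0 := by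
  obtain ⟨σ, h1, h2, h3⟩ := hr.exists_partner
  have two : ∀ u v : ZMod 2, u = v → u + v = 0 := by decide
  exact Finset.sum_involution (fun x _ => σ x)
    (fun x _ => two _ _ (hχ _ _ ((h3 x _).2 (Or.inr rfl))))
    (fun x _ _ => h1 x) (fun _ _ => Finset.mem_univ _) (fun x _ => h2 x)

theorem comp_matching_exists {a b : Setoid (Fin n ⊕ Fin n)} (ha : IsMatching a)
    (hb : IsMatching b) (z : Fin n ⊕ Fin n) : ∃ y, comp a b z y ∧ y ≠ z := by
  classical
  by_contra hn
  push Not at hn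
  let χ : Fin n ⊕ (Fin n ⊕ Fin n) → ZMod 2 := fun p => if stack a b (outer z) p then 1 else 0
  have hχ : ∀ p q, stack a b p q → χ p = χ q := by
    intro p q h
    have : stack a b (outer z) p ↔ stack a b (outer z) q :=
      ⟨fun h' => Setoid.trans' _ h' h, fun h' => Setoid.trans' _ h' (Setoid.symm' _ h)⟩
    simp only [χ, this]
  have h1 := ha.sum_eq_zero (fun x => χ (upper x)) fun x y h => hχ _ _ (stack_upper a b h)
  have h2 := hb.sum_eq_zero (fun x => χ (lower x)) fun x y h => hχ _ _ (stack_lower a b h)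
  have h3 : ∑ x, χ (outer x) = 1 := by
    rw [Finset.sum_eq_single z]
    · exact if_pos (Setoid.refl' _ _)
    · intro y _ hy
      exact if_neg fun h => hy (hn y h)
    · intro h
      exact absurd (Finset.mem_univ _) h
  rw [Fintype.sum_sum_type] at h1 h2 h3
  have k : ∀ p q r : ZMod 2, p + q = 0 → q + r = 0 → p + r = 1 → False := by decide
  exact k _ _ _ h1 h2 h3

theorem IsMatching.comp {a b : Setoid (Fin n ⊕ Fin n)} (ha : IsMatching a) (hb : IsMatching b) :
    IsMatching (comp a b) := by
  rintro _ ⟨z, rfl⟩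
  obtain ⟨y, hy, hyz⟩ := comp_matching_exists ha hb z
  rw [Set.ncard_eq_two]
  refine ⟨z, y, hyz.symm, Set.ext fun w => ⟨fun hw => ?_, ?_⟩⟩
  · by_cases hwz : w = z
    · exact Or.inl hwz
    · exact Or.inr (comp_matching_unique ha hb (Setoid.symm' _ hw) hy hwz hyz)
  · rintro (rfl | rfl)
    · exact Setoid.refl' (CyclicDiagram.comp a b) w
    · exact Setoid.symm' _ hy

theorem isPlanar_id : IsPlanar (idDiagram (Fin n)) := by
  rintro (w | w) (x | x) (y | y) (z | z) h1 h2 h3 h4 h5 <;> simp only [pos] at h1 h2 h3 <;>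
    (have h4' : w = y := h4
     have h5' : x = z := h5
     subst h4' h5'
     omega)

theorem isMatching_id : IsMatching (idDiagram (Fin n)) := by
  rintro _ ⟨z, rfl⟩
  rw [Set.ncard_eq_two]
  refine ⟨Sum.inl (Sum.elim id id z), Sum.inr (Sum.elim id id z), by simp, Set.ext fun w => ?_⟩
  change Sum.elim id id w = Sum.elim id id z ↔ w = _ ∨ w = _
  rcases w with w | w <;> simp

theorem exists_top_link {a b : Setoid (Fin n ⊕ Fin n)} {i j : Fin n}
    (h : comp a b (Sum.inl i) (Sum.inr j)) :
    ∃ i' u, comp a b (Sum.inl i') (Sum.inl i) ∧ a (Sum.inl i') (Sum.inr u) := by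
  by_contra hn
  push Not at hn
  have hle : stack a b ≤
      Setoid.ker (fun p => ∃ i', p = Sum.inl i' ∧ comp a b (Sum.inl i') (Sum.inl i)) := by
    refine stack_le (fun x y hxy => propext ?_) (fun x y hxy => propext ?_)
    · rcases x with x | x <;> rcases y with y | y
      · have hs : comp a b (Sum.inl x) (Sum.inl y) := stack_upper a b hxy
        constructor
        · rintro ⟨_, h1, h2⟩
          cases Sum.inl_injective h1
          exact ⟨y, rfl, Setoid.trans' _ (Setoid.symm' _ hs) h2⟩
        · rintro ⟨_, h1, h2⟩
          cases Sum.inl_injective h1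
          exact ⟨x, rfl, Setoid.trans' _ hs h2⟩
      · constructor
        · rintro ⟨_, h1, h2⟩
          cases Sum.inl_injective h1
          exact absurd hxy (hn _ _ h2)
        · rintro ⟨_, h1, _⟩
          simp [upper] at h1
      · constructor
        · rintro ⟨_, h1, _⟩
          simp [upper] at h1
        · rintro ⟨_, h1, h2⟩
          cases Sum.inl_injective h1
          exact absurd (Setoid.symm' _ hxy) (hn _ _ h2)
      · simp [upper]
    · simp [lower]
  have := (iff_of_eq (hle (show stack a b _ _ from h))).1 ⟨i, rfl, Setoid.refl' _ _⟩
  obtain ⟨_, h1, _⟩ := this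
  simp [outer] at h1

theorem exists_bot_link {a b : Setoid (Fin n ⊕ Fin n)} {i j : Fin n}
    (h : comp a b (Sum.inl i) (Sum.inr j)) :
    ∃ j' u, comp a b (Sum.inr j') (Sum.inr j) ∧ b (Sum.inl u) (Sum.inr j') := by
  by_contra hn
  push Not at hn
  have hle : stack a b ≤ Setoid.ker
      (fun p => ∃ j', p = Sum.inr (Sum.inr j') ∧ comp a b (Sum.inr j') (Sum.inr j)) := by
    refine stack_le (fun x y hxy => propext ?_) (fun x y hxy => propext ?_)
    · rcases x with x | x <;> rcases y with y | y <;> simp [upper]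
    · rcases x with x | x <;> rcases y with y | y
      · simp [lower]
      · constructor
        · rintro ⟨_, h1, _⟩
          simp [lower] at h1
        · rintro ⟨_, h1, h2⟩
          cases Sum.inr_injective (Sum.inr_injective h1)
          exact absurd hxy (hn _ _ h2)
      · constructor
        · rintro ⟨_, h1, h2⟩
          cases Sum.inr_injective (Sum.inr_injective h1)
          exact absurd (Setoid.symm' _ hxy) (hn _ _ h2)
        · rintro ⟨_, h1, _⟩
          simp [lower] at h1
      · have hs : comp a b (Sum.inr x) (Sum.inr y) := stack_lower a b hxy
        constructor
        · rintro ⟨_, h1, h2⟩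
          cases Sum.inr_injective (Sum.inr_injective h1)
          exact ⟨y, rfl, Setoid.trans' _ (Setoid.symm' _ hs) h2⟩
        · rintro ⟨_, h1, h2⟩
          cases Sum.inr_injective (Sum.inr_injective h1)
          exact ⟨x, rfl, Setoid.trans' _ hs h2⟩
  have := (iff_of_eq (hle (show stack a b _ _ from h))).2 ⟨j, rfl, Setoid.refl' _ _⟩
  obtain ⟨_, h1, _⟩ := this
  simp [outer] at h1

theorem throughStrands_comp_le_left (a b : Setoid (Fin n ⊕ Fin n)) :
    throughStrands (comp a b) ≤ throughStrands a := by
  have h : ∀ s, s ∈ (comp a b).classes ∧ (∃ i, Sum.inl i ∈ s) ∧ (∃ j, Sum.inr j ∈ s) →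
      ∃ t, (t ∈ a.classes ∧ (∃ i, Sum.inl i ∈ t) ∧ ∃ j, Sum.inr j ∈ t) ∧
        ∃ x, s = {y | comp a b y (Sum.inl x)} ∧ t = {y | a y (Sum.inl x)} := by
    rintro _ ⟨⟨z, rfl⟩, ⟨i, hi⟩, ⟨j, hj⟩⟩
    obtain ⟨x, u, hx, hu⟩ := exists_top_link (Setoid.trans' _ hi (Setoid.symm' _ hj))
    have hxz : comp a b (Sum.inl x) z := Setoid.trans' _ hx hi
    exact ⟨{y | a y (Sum.inl x)}, ⟨⟨_, rfl⟩, ⟨x, a.refl' _⟩, ⟨u, a.symm' hu⟩⟩, x,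
      Set.ext fun y => ⟨fun hy => Setoid.trans' _ hy (Setoid.symm' _ hxz),
        fun hy => Setoid.trans' _ hy hxz⟩, rfl⟩
  choose! t ht hst using h
  refine Set.ncard_le_ncard_of_injOn t ht ?_ (Set.toFinite _)
  intro s hs s' hs' he
  obtain ⟨x, h1, h2⟩ := hst s hs
  obtain ⟨x', h1', h2'⟩ := hst s' hs'
  rw [h2, h2'] at he
  have hm : (Sum.inl x : Fin n ⊕ Fin n) ∈ {y | a y (Sum.inl x')} :=
    (congrArg (fun w => (Sum.inl x : Fin n ⊕ Fin n) ∈ w) he).mp (a.refl' _)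
  have hc : comp a b (Sum.inl x) (Sum.inl x') := stack_upper a b hm
  rw [h1, h1']
  exact Set.ext fun y => ⟨fun hy => Setoid.trans' _ hy hc,
    fun hy => Setoid.trans' _ hy (Setoid.symm' _ hc)⟩

theorem throughStrands_comp_le_right (a b : Setoid (Fin n ⊕ Fin n)) :
    throughStrands (comp a b) ≤ throughStrands b := by
  have h : ∀ s, s ∈ (comp a b).classes ∧ (∃ i, Sum.inl i ∈ s) ∧ (∃ j, Sum.inr j ∈ s) →
      ∃ t, (t ∈ b.classes ∧ (∃ i, Sum.inl i ∈ t) ∧ ∃ j, Sum.inr j ∈ t) ∧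
        ∃ x, s = {y | comp a b y (Sum.inr x)} ∧ t = {y | b y (Sum.inr x)} := by
    rintro _ ⟨⟨z, rfl⟩, ⟨i, hi⟩, ⟨j, hj⟩⟩
    obtain ⟨x, u, hx, hu⟩ := exists_bot_link (Setoid.trans' _ hi (Setoid.symm' _ hj))
    have hxz : comp a b (Sum.inr x) z := Setoid.trans' _ hx hj
    exact ⟨{y | b y (Sum.inr x)}, ⟨⟨_, rfl⟩, ⟨u, hu⟩, ⟨x, b.refl' _⟩⟩, x,
      Set.ext fun y => ⟨fun hy => Setoid.trans' _ hy (Setoid.symm' _ hxz),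
        fun hy => Setoid.trans' _ hy hxz⟩, rfl⟩
  choose! t ht hst using h
  refine Set.ncard_le_ncard_of_injOn t ht ?_ (Set.toFinite _)
  intro s hs s' hs' he
  obtain ⟨x, h1, h2⟩ := hst s hs
  obtain ⟨x', h1', h2'⟩ := hst s' hs'
  rw [h2, h2'] at he
  have hm : (Sum.inr x : Fin n ⊕ Fin n) ∈ {y | b y (Sum.inr x')} :=
    (congrArg (fun w => (Sum.inr x : Fin n ⊕ Fin n) ∈ w) he).mp (b.refl' _)
  have hc : comp a b (Sum.inr x) (Sum.inr x') := stack_lower a b hm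
  rw [h1, h1']
  exact Set.ext fun y => ⟨fun hy => Setoid.trans' _ hy hc,
    fun hy => Setoid.trans' _ hy (Setoid.symm' _ hc)⟩

end Planar

/-! ### Cyclic diagram monoids -/

/-- A diagram on `n` strands with internal components counted modulo `m`: a partition of the
`n` top points (`Sum.inl`) and the `n` bottom points (`Sum.inr`), and a residue modulo `m`. -/
@[ext]
structure CyclicPartition (m n : ℕ) where
  /-- the partition of the boundary points -/
  skeleton : Setoid (Fin n ⊕ Fin n)
  /-- the number of internal components modulo `m` -/
  bubbles : ZMod m

/-- Multiplication by concatenation: `(a, i) (b, j) = (ab, i + j + Φ(a, b))`. -/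
noncomputable instance (m n : ℕ) : Monoid (CyclicPartition m n) where
  mul x y := ⟨comp x.skeleton y.skeleton,
    x.bubbles + y.bubbles + (internal x.skeleton y.skeleton : ZMod m)⟩
  one := ⟨idDiagram (Fin n), 0⟩
  mul_assoc x y z := by
    refine CyclicPartition.ext (comp_assoc _ _ _) ?_
    have h := congrArg (Nat.cast : ℕ → ZMod m)
      (internal_assoc x.skeleton y.skeleton z.skeleton)
    push_cast at h
    change x.bubbles + y.bubbles + _ + z.bubbles + _ = x.bubbles + (y.bubbles + z.bubbles + _) + _
    linear_combination h
  one_mul x := by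
    refine CyclicPartition.ext (id_comp _) ?_
    change 0 + x.bubbles + ((internal (idDiagram (Fin n)) x.skeleton : ℕ) : ZMod m) = x.bubbles
    rw [internal_id_left]; simp
  mul_one x := by
    refine CyclicPartition.ext (comp_id _) ?_
    change x.bubbles + 0 + ((internal x.skeleton (idDiagram (Fin n)) : ℕ) : ZMod m) = x.bubbles
    rw [internal_id_right]; simp

/-- The `m`-cyclic planar partition monoid on `n` strands. -/
def planarPartitionMonoid (m n : ℕ) : Submonoid (CyclicPartition m n) where
  carrier := {x | IsPlanar x.skeleton}
  mul_mem' hx hy := IsPlanar.comp hx hy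
  one_mem' := isPlanar_id

/-- The `m`-cyclic Temperley–Lieb monoid on `n` strands: crossingless matchings, that is, planar
partitions into blocks of size two. -/
def temperleyLiebMonoid (m n : ℕ) : Submonoid (CyclicPartition m n) where
  carrier := {x | IsPlanar x.skeleton ∧ IsMatching x.skeleton}
  mul_mem' hx hy := ⟨IsPlanar.comp hx.1 hy.1, IsMatching.comp hx.2 hy.2⟩
  one_mem' := ⟨isPlanar_id, isMatching_id⟩

section Truncation

variable {m n : ℕ}

/-- The submonoid of a diagram monoid consisting of the identity and of all the diagrams with at
most `l` through strands. -/
def atMost (P : Submonoid (CyclicPartition m n)) (l : ℕ) : Submonoid (CyclicPartition m n) where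
  carrier := {x | x ∈ P ∧ (x = 1 ∨ throughStrands x.skeleton ≤ l)}
  mul_mem' := by
    rintro x y ⟨hx, hx'⟩ ⟨hy, hy'⟩
    refine ⟨P.mul_mem hx hy, ?_⟩
    rcases hx' with rfl | hx'
    · rw [one_mul]; exact hy'
    · exact Or.inr ((throughStrands_comp_le_left _ _).trans hx')
  one_mem' := ⟨P.one_mem, Or.inl rfl⟩

/-- The Rees congruence that identifies all diagrams with fewer than `k` through strands. -/
def reesCon (P : Submonoid (CyclicPartition m n)) (k l : ℕ) : Con (atMost P l) where
  r x y := x = y ∨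
    (throughStrands x.1.skeleton < k ∧ throughStrands y.1.skeleton < k)
  iseqv := by
    refine ⟨fun _ => Or.inl rfl, ?_, ?_⟩
    · rintro x y (h | h)
      · exact Or.inl h.symm
      · exact Or.inr h.symm
    · rintro x y z (rfl | h) (rfl | h')
      · exact Or.inl rfl
      · exact Or.inr h'
      · exact Or.inr h
      · exact Or.inr ⟨h.1, h'.2⟩
  mul' := by
    rintro w x y z (rfl | h) (rfl | h')
    · exact Or.inl rfl
    · exact Or.inr ⟨(throughStrands_comp_le_right _ _).trans_lt h'.1,
        (throughStrands_comp_le_right _ _).trans_lt h'.2⟩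
    · exact Or.inr ⟨(throughStrands_comp_le_left _ _).trans_lt h.1,
        (throughStrands_comp_le_left _ _).trans_lt h.2⟩
    · exact Or.inr ⟨(throughStrands_comp_le_left _ _).trans_lt h.1,
        (throughStrands_comp_le_left _ _).trans_lt h.2⟩

/-- The truncation of a diagram monoid to between `k` and `l` through strands: the Rees factor of
the submonoid of diagrams with at most `l` through strands (and the identity) by the ideal of
diagrams with fewer than `k` through strands, which become the zero element. -/
abbrev Truncation (P : Submonoid (CyclicPartition m n)) (k l : ℕ) : Type :=
  (reesCon P k l).Quotient

end Truncation

end CyclicDiagram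

/-! ### Representation gap -/

namespace RepGap

universe u v

variable (K : Type u) [Field K] (S : Type v) [Monoid S]

/-- A representation isomorphic to a finite direct sum of copies of the trivial representations
`1_t` (every element acts by `1`) and `1_b` (units act by `1`, all the other elements by `0`):
it has a basis of vectors each of which spans a copy of `1_t` or of `1_b`. -/
def IsSumOfTrivial {K : Type u} [Field K] {S : Type v} [Monoid S] {V : Type u} [AddCommGroup V]
    [Module K V] (ρ : Representation K S V) : Prop :=
  ∃ (d : ℕ) (b : Module.Basis (Fin d) K V), ∀ i,
    (∀ s, ρ s (b i) = b i) ∨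
      ∀ s, (IsUnit s → ρ s (b i) = b i) ∧ (¬ IsUnit s → ρ s (b i) = 0)

/-- `S` is the trivial group or the two-element monoid `{1, a}` with `a * a = a`. -/
def IsExceptional : Prop :=
  Nonempty (S ≃* Unit) ∨ Nonempty (S ≃* WithZero Unit)

/-- `(S, K)` is `d`-trivial: all representations of dimension at most `d` are sums of trivial
representations. The two exceptional monoids are only `(-1)`-trivial, by convention. -/
def IsTrivialUpTo (d : ℤ) : Prop :=
  (IsExceptional S → d = -1) ∧
    ∀ (V : Type u) [AddCommGroup V] [Module K V] [FiniteDimensional K V]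
      (ρ : Representation K S V), (Module.finrank K V : ℤ) ≤ d → IsSumOfTrivial ρ

/-- The representation gap: the largest `g` such that `(S, K)` is `(g - 1)`-trivial. -/
noncomputable def gap : ℕ∞ :=
  sSup {g : ℕ∞ | ∃ d : ℕ, g = d ∧ IsTrivialUpTo K S ((d : ℤ) - 1)}

end RepGap

/-! Thickening every block of a planar partition `a` on n strands and keeping only the boundary
curves gives a crossingless matching `fatten a` on 2n strands. This is a bijection onto the
crossingless matchings (`fatten_injective`, `exists_fatten_eq`). It respects concatenation and
doubles the number of through strands (`throughStrands_fatten`).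

Write |a| for the number of blocks. Euler's formula for the glued surface counts the closed loops
formed when `fatten a` meets `fatten b`: their number is n + 2Φ(a,b) + |ab| - |a| - |b|
(`comp_fatten_and_internal_fatten`). So the loop count is twice Φ up to the coboundary of |a| - n,
and (a, i) ↦ (fatten a, 2i + |a| - n) is an injective homomorphism from the m-cyclic planar
partition monoid to the 2m-cyclic Temperley–Lieb monoid. It descends to the truncations, giving an
embedding f : S → T (`truncationHom`).

It remains to carry d-triviality from S to T (`IsTrivialUpTo.of_injective`). Restrict a
representation of T to S and take a basis of trivial vectors. Since k ≥ 1, the diagram of singletons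
is a zero of S whose image is a zero of T. On a vector of type 1_t this zero acts by 1, hence so
does every t in T, because t · 0 = 0. On a vector of type 1_b it is enough that each nonunit of T
has the form t' f(s) with s a nonunit of S. This comes from the regularity identity a = a(a*a), with
a* the reflection of `a`; the residue is absorbed by t' (`exists_eq_mul_fattenHom`).

The loop count is proved by gluing the middle points one pair at a time, innermost first, while
tracking the partition, its boundary and an Euler-type invariant (`IsBoundaryOn.glue`,
`exists_glue`). -/

namespace CyclicDiagram

/-! ### Boundary curves of a partition of points on a line, and counts of blocks. -/

section Boundary

variable {X : Type}

/-- The boundary of the blocks of `r`: each point `p` is doubled into `(p, false)`, just before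
`p`, and `(p, true)`, just after `p`. Two of these are joined when they lie on the same block and
no block of `r`, restricted to `A`, crosses the chord between them. -/
def boundary (P : X → ℕ) (A : Set X) (r : Setoid X) : Setoid (X × Bool) where
  -- The inequality says that `u` comes after the doubled point `x`. Hence the equivalence between
  -- its versions for `x` and `y` says that `u` lies outside the chord from `x` to `y`, and the
  -- outer equivalence puts `u` and `v` on the same side. The block of `x` itself is included among
  -- the `u`, `v`, which forces the ends of a chord to be cyclically consecutive in their block.
  r x y := r x.1 y.1 ∧ ∀ u ∈ A, ∀ v ∈ A, r u v →
    (((2 * P x.1 + x.2.toNat ≤ 2 * P u) ↔ (2 * P y.1 + y.2.toNat ≤ 2 * P u)) ↔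
      ((2 * P x.1 + x.2.toNat ≤ 2 * P v) ↔ (2 * P y.1 + y.2.toNat ≤ 2 * P v)))
  iseqv := by
    refine ⟨fun x => ⟨r.refl' _, fun u _ v _ _ => by simp⟩, ?_, ?_⟩
    · rintro x y ⟨h, h'⟩
      refine ⟨r.symm' h, fun u hu v hv huv => ?_⟩
      have := h' u hu v hv huv
      tauto
    · rintro x y z ⟨h1, h1'⟩ ⟨h2, h2'⟩
      refine ⟨r.trans' h1 h2, fun u hu v hv huv => ?_⟩
      have h3 := h1' u hu v hv huv
      have h4 := h2' u hu v hv huv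
      tauto

/-- If two ends on the same side of different points were joined, the chord would separate these two
points, although they lie in one block. So strands run from a `true` end to a `false` end. -/
theorem boundary_eq {P : X → ℕ} (hP : Function.Injective P) {A : Set X} {r : Setoid X}
    {x y : X × Bool} (h : boundary P A r x y) (hx : x.1 ∈ A) (hy : y.1 ∈ A) (hxy : x.2 = y.2) :
    x = y := by
  have h1 := h.2 _ hx _ hy h.1
  rw [hxy] at h1
  refine Prod.ext (hP ?_) hxy
  rcases y with ⟨y, _ | _⟩ <;> simp only [Bool.toNat_true, Bool.toNat_false] at h1 ⊢ <;> omega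

/-- No two blocks interleave, for the order of the positions `P`. -/
def Noncrossing (P : X → ℕ) (r : Setoid X) : Prop :=
  ∀ w x y z, P w < P x → P x < P y → P y < P z → r w y → r x z → r w x

/-- The partner sits at the next point of the block, or at the first point of the block when `p` is
the last one (possibly `p` itself). A block separated by this chord would cross the block of `p`. -/
theorem exists_boundary_true [Finite X] {P : X → ℕ} (hP : Function.Injective P) {r : Setoid X}
    (hr : Noncrossing P r) (p : X) : ∃ q, boundary P Set.univ r (p, true) (q, false) := by
  by_cases hex : {v | r p v ∧ P p < P v}.Nonempty
  · obtain ⟨q, ⟨hq1, hq2⟩, hmin⟩ := Set.exists_min_image _ P (Set.toFinite _) hex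
    refine ⟨q, hq1, fun u _ v _ huv => ?_⟩
    have key : ∀ u v, r u v → P p < P u → P u < P q → P p < P v ∧ P v < P q := by
      intro u v huv h1 h2
      have hu : ¬ r p u := fun h => absurd (hmin u ⟨h, h1⟩) (by omega)
      have hvp : P v ≠ P p := fun h => hu (r.symm' (hP h ▸ huv))
      have hvq : P v ≠ P q := fun h => hu (r.trans' hq1 (r.symm' (hP h ▸ huv)))
      by_contra hn
      rcases lt_or_ge (P v) (P p) with h3 | h3
      · exact hu (r.trans' (r.symm' (hr v p u q h3 h1 h2 (r.symm' huv) hq1)) (r.symm' huv))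
      · exact hu (hr p u q v h1 h2 (by omega) hq1 huv)
    have k1 := key u v huv
    have k2 := key v u (r.symm' huv)
    simp only [Bool.toNat_true, Bool.toNat_false]
    omega
  · obtain ⟨q, hq1, hmin⟩ := Set.exists_min_image {v | r p v} P (Set.toFinite _) ⟨p, r.refl' p⟩
    have hmax : ∀ v, r p v → P v ≤ P p := fun v hv => by
      by_contra h
      exact hex ⟨v, hv, by omega⟩
    have hq1 : r p q := hq1
    have hqp := hmax q hq1
    refine ⟨q, hq1, fun u _ v _ huv => ?_⟩
    have key : ∀ u v, r u v → P q ≤ P u → P u ≤ P p → P q ≤ P v ∧ P v ≤ P p := by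
      intro u v huv h1 h2
      by_cases hu : r p u
      · exact ⟨hmin v (r.trans' hu huv), hmax v (r.trans' hu huv)⟩
      have hup : P u ≠ P p := fun h => hu (hP h ▸ r.refl' _)
      have huq : P u ≠ P q := fun h => hu (hP h ▸ hq1)
      by_contra hn
      rcases lt_or_ge (P v) (P q) with h3 | h3
      · exact hu (r.trans' hq1 (r.trans' (r.symm' (hr v q u p h3 (by omega) (by omega)
          (r.symm' huv) (r.symm' hq1))) (r.symm' huv)))
      · exact hu (r.trans' hq1 (hr q u p v (by omega) (by omega) (by omega) (r.symm' hq1) huv))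
    have k1 := key u v huv
    have k2 := key v u (r.symm' huv)
    simp only [Bool.toNat_true, Bool.toNat_false]
    omega

/-- The successor map inside blocks is injective by `boundary_eq`, hence surjective by finiteness;
this supplies the partners of the `false` ends. -/
theorem exists_boundary [Finite X] {P : X → ℕ} (hP : Function.Injective P) {r : Setoid X}
    (hr : Noncrossing P r) (x : X × Bool) : ∃ y, y ≠ x ∧ boundary P Set.univ r x y := by
  choose σ hσ using exists_boundary_true hP hr
  have hinj : Function.Injective σ := fun p q h => by
    have h1 := hσ q
    rw [← h] at h1
    exact congrArg Prod.fst (boundary_eq hP (Setoid.trans' _ (hσ p) (Setoid.symm' _ h1))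
      (Set.mem_univ _) (Set.mem_univ _) rfl)
  rcases x with ⟨p, _ | _⟩
  · obtain ⟨q, rfl⟩ := Finite.injective_iff_surjective.1 hinj p
    exact ⟨(q, true), by simp, Setoid.symm' _ (hσ q)⟩
  · exact ⟨(σ p, false), by simp, hσ p⟩

/-! ### Joining two blocks -/

/-- The partition obtained from `r` by joining the blocks of `p` and `q`. -/
def addPair (r : Setoid X) (p q : X) : Setoid X where
  r x y := r x y ∨ (r x p ∧ r q y) ∨ (r x q ∧ r p y)
  iseqv := by
    refine ⟨fun x => Or.inl (r.refl' x), ?_, ?_⟩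
    · rintro x y (h | ⟨h, h'⟩ | ⟨h, h'⟩)
      · exact Or.inl (r.symm' h)
      · exact Or.inr (Or.inr ⟨r.symm' h', r.symm' h⟩)
      · exact Or.inr (Or.inl ⟨r.symm' h', r.symm' h⟩)
    · rintro x y z (h | ⟨h, h'⟩ | ⟨h, h'⟩) (k | ⟨k, k'⟩ | ⟨k, k'⟩)
      · exact Or.inl (r.trans' h k)
      · exact Or.inr (Or.inl ⟨r.trans' h k, k'⟩)
      · exact Or.inr (Or.inr ⟨r.trans' h k, k'⟩)
      · exact Or.inr (Or.inl ⟨h, r.trans' h' k⟩)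
      · exact Or.inr (Or.inl ⟨h, k'⟩)
      · exact Or.inl (r.trans' h k')
      · exact Or.inr (Or.inr ⟨h, r.trans' h' k⟩)
      · exact Or.inl (r.trans' h k')
      · exact Or.inr (Or.inr ⟨h, k'⟩)

theorem le_addPair (r : Setoid X) (p q : X) : r ≤ addPair r p q := fun _ _ h => Or.inl h

theorem addPair_self (r : Setoid X) (p q : X) : addPair r p q p q :=
  Or.inr (Or.inl ⟨r.refl' _, r.refl' _⟩)

theorem addPair_le {r s : Setoid X} {p q : X} : addPair r p q ≤ s ↔ r ≤ s ∧ s p q := by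
  refine ⟨fun h => ⟨(le_addPair r p q).trans h, h (addPair_self r p q)⟩, ?_⟩
  rintro ⟨h, h'⟩ x y (k | ⟨k, k'⟩ | ⟨k, k'⟩)
  · exact h k
  · exact s.trans' (h k) (s.trans' h' (h k'))
  · exact s.trans' (h k) (s.trans' (s.symm' h') (h k'))

theorem addPair_eq_self {r : Setoid X} {p q : X} (h : r p q) : addPair r p q = r :=
  le_antisymm (addPair_le.2 ⟨le_rfl, h⟩) (le_addPair r p q)

/-! ### Counting blocks -/

/-- The block of `x`. -/
def block (r : Setoid X) (x : X) : Set X := {y | r y x}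

theorem block_eq {r : Setoid X} {x y : X} : block r x = block r y ↔ r x y := by
  refine ⟨fun h => ?_, fun h => Set.ext fun z => ⟨fun k => r.trans' k h,
    fun k => r.trans' k (r.symm' h)⟩⟩
  have : x ∈ block r x := r.refl' x
  rw [h] at this
  exact this

/-- The number of blocks of `r` that meet `A`. -/
noncomputable def numBlocks (r : Setoid X) (A : Set X) : ℕ := (block r '' A).ncard

theorem ncard_image_congr {Y Z W : Type} {A : Set Y} {f : Y → Z} {g : Y → W}
    (h : ∀ u ∈ A, ∀ v ∈ A, f u = f v ↔ g u = g v) : (f '' A).ncard = (g '' A).ncard := by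
  have aux : ∀ {V : Type} (k : Y → V), (k '' A).ncard =
      Nat.card (Quotient (Setoid.ker (fun a : A => k a))) := fun k => by
    rw [← Nat.card_coe_set_eq, Nat.card_congr (Setoid.quotientKerEquivRange (fun a : A => k a)),
      Set.image_eq_range]
  rw [aux, aux]
  have : Setoid.ker (fun a : A => f a) = Setoid.ker (fun a : A => g a) :=
    Setoid.ext fun u v => h u u.2 v v.2
  rw [this]

/-- The map `f` need not be injective, so this serves both for inclusions of outer points and for
the surjections that identify middle points. -/
theorem numBlocks_image {Y : Type} {r : Setoid X} {s : Setoid Y} {A : Set Y} (f : Y → X)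
    (h : ∀ u ∈ A, ∀ v ∈ A, s u v ↔ r (f u) (f v)) : numBlocks r (f '' A) = numBlocks s A := by
  unfold numBlocks
  rw [← Set.image_comp]
  refine ncard_image_congr fun u hu v hv => ?_
  rw [Function.comp, Function.comp, block_eq, block_eq, h u hu v hv]

-- Only points of the block of `p` are removed, so at most that block is lost, and it is lost
-- exactly when nothing of it survives in `B`.
open Classical in
theorem numBlocks_remove [Finite X] {r : Setoid X} {A B : Set X} {p : X} (hp : p ∈ A)
    (hBA : B ⊆ A) (h : ∀ u ∈ A, u ∉ B → r u p) :
    numBlocks r A = numBlocks r B + if ∃ u ∈ B, r u p then 0 else 1 := by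
  have : block r '' A = insert (block r p) (block r '' B) := by
    ext s
    constructor
    · rintro ⟨u, hu, rfl⟩
      by_cases huB : u ∈ B
      · exact Or.inr ⟨u, huB, rfl⟩
      · exact Or.inl (block_eq.2 (h u hu huB))
    · rintro (rfl | ⟨u, hu, rfl⟩)
      · exact ⟨p, hp, rfl⟩
      · exact ⟨u, hBA hu, rfl⟩
  have hm : block r p ∈ block r '' B ↔ ∃ u ∈ B, r u p :=
    exists_congr fun u => and_congr_right fun _ => block_eq
  unfold numBlocks
  rw [this]
  split_ifs with hc
  · rw [Set.insert_eq_of_mem (hm.2 hc), add_zero]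
  · rw [Set.ncard_insert_of_notMem (mt hm.1 hc) (Set.toFinite _)]

-- Leave out the block of `q`. Before joining, this loses a block; after joining, `p` still
-- represents it. On the points left over the two partitions agree.
open Classical in
theorem numBlocks_addPair [Finite X] {r : Setoid X} {A : Set X} {p q : X} (hp : p ∈ A)
    (hq : q ∈ A) :
    numBlocks (addPair r p q) A + (if r p q then 0 else 1) = numBlocks r A := by
  split_ifs with h
  · rw [addPair_eq_self h, add_zero]
  · have hB : {u | u ∈ A ∧ ¬ r u q} ⊆ A := fun u hu => hu.1
    have h0 : ∀ u ∈ A, u ∉ {u | u ∈ A ∧ ¬ r u q} → r u q := fun u hu hn => by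
      by_contra hc
      exact hn ⟨hu, hc⟩
    have h1 := numBlocks_remove hq hB h0
    have h2 := numBlocks_remove (r := addPair r p q) hq hB fun u hu hn => Or.inl (h0 u hu hn)
    rw [if_neg (fun ⟨u, hu, hu'⟩ => hu.2 hu')] at h1
    rw [if_pos ⟨p, ⟨hp, h⟩, addPair_self r p q⟩] at h2
    rw [h1, h2, add_zero]
    congr 1
    have := numBlocks_image (r := addPair r p q) (s := r) (A := {u | u ∈ A ∧ ¬ r u q}) id
      fun u hu v hv => by
        refine ⟨Or.inl, ?_⟩
        rintro (k | ⟨_, k⟩ | ⟨k, _⟩)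
        · exact k
        · exact absurd (r.symm' k) hv.2
        · exact absurd k hu.2
    rwa [Set.image_id] at this

end Boundary

/-! ### Gluing two neighbouring points, and its effect on boundaries and counts. -/

section Contraction

variable {X : Type}

/-- Being inside a chord is a parity, additive under concatenation of chords. Here two chords are
concatenated whose inner ends are not separated by either of the two points considered. The primed
variant chains two pairs of points for a fixed chord. -/
theorem iff_iff_trans {a b c d a' b' c' d' : Prop} (h : (a ↔ b) ↔ (a' ↔ b'))
    (k : (c ↔ d) ↔ (c' ↔ d')) (e : b ↔ c) (e' : b' ↔ c') : (a ↔ d) ↔ (a' ↔ d') := by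
  obtain rfl := propext e
  obtain rfl := propext e'
  by_cases b <;> by_cases b' <;> by_cases a' <;> by_cases d' <;> simp_all

theorem iff_iff_trans' {a b a' b' c d c' d' : Prop} (h : (a ↔ b) ↔ (c ↔ d))
    (k : (a' ↔ b') ↔ (c' ↔ d')) (e : c ↔ a') (e' : d ↔ b') : (a ↔ b) ↔ (c' ↔ d') := by
  obtain rfl := propext e
  obtain rfl := propext e'
  exact h.trans k

/-- Joining two points of a partition into pairs leaves a partition into pairs of the others. -/
theorem exists_partner_addPair {Y : Type} {N : Setoid Y} {F : Set Y} {c d : Y}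
    (ex : ∀ x ∈ F, ∃ y ∈ F, y ≠ x ∧ N x y)
    (uniq : ∀ x ∈ F, ∀ y ∈ F, ∀ z ∈ F, y ≠ x → z ≠ x → N x y → N x z → y = z)
    (hc : c ∈ F) (hd : d ∈ F) (hcd : c ≠ d) {x : Y} (hx : x ∈ F) (hxc : x ≠ c) (hxd : x ≠ d) :
    ∃ y ∈ F, y ≠ c ∧ y ≠ d ∧ y ≠ x ∧ addPair N c d x y := by
  obtain ⟨y, hy, hyx, hxy⟩ := ex x hx
  -- If `x` was paired with `c`, its new partner is the old partner of `d`, and symmetrically.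
  -- Uniqueness of partners shows that this point is neither `x` nor one of the two ends that
  -- disappear.
  by_cases hyc : y = c
  · subst hyc
    obtain ⟨z, hz, hzd, hdz⟩ := ex d hd
    refine ⟨z, hz, ?_, hzd, ?_, Or.inr (Or.inl ⟨hxy, hdz⟩)⟩
    · rintro rfl
      exact hxd (uniq z hy x hx d hd hyx.symm hcd.symm (N.symm' hxy) (N.symm' hdz))
    · rintro rfl
      exact hcd (uniq z hx y hy d hd hyx hxd.symm hxy (N.symm' hdz))
  by_cases hyd : y = d
  · subst hyd
    obtain ⟨z, hz, hzc, hcz⟩ := ex c hc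
    refine ⟨z, hz, hzc, ?_, ?_, Or.inr (Or.inr ⟨hxy, hcz⟩)⟩
    · rintro rfl
      exact hxc (uniq z hy x hx c hc hyx.symm hcd (N.symm' hxy) (N.symm' hcz))
    · rintro rfl
      exact hcd (uniq z hx c hc y hy hxc.symm hyx (N.symm' hcz) hxy)
  exact ⟨y, hy, hyc, hyd, hyx, Or.inl hxy⟩

/-- On the points of `F`, the partition `N` into pairs is the boundary of `r`. -/
structure IsBoundaryOn (P : X → ℕ) (F : Set (X × Bool)) (A : Set X) (r : Setoid X)
    (N : Setoid (X × Bool)) : Prop where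
  sub : ∀ x ∈ F, x.1 ∈ A
  le : ∀ x ∈ F, ∀ y ∈ F, N x y → boundary P A r x y
  ex : ∀ x ∈ F, ∃ y ∈ F, y ≠ x ∧ N x y

namespace IsBoundaryOn

variable {P : X → ℕ} {F : Set (X × Bool)} {A : Set X} {r : Setoid X} {N : Setoid (X × Bool)}

theorem snd_ne (hP : Function.Injective P) (h : IsBoundaryOn P F A r N) {x y : X × Bool}
    (hx : x ∈ F) (hy : y ∈ F) (hxy : boundary P A r x y) (hne : y ≠ x) : y.2 ≠ x.2 :=
  fun e => hne (boundary_eq hP hxy (h.sub x hx) (h.sub y hy) e.symm).symm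

theorem boundary_uniq (hP : Function.Injective P) (h : IsBoundaryOn P F A r N)
    {x y z : X × Bool} (hx : x ∈ F) (hy : y ∈ F) (hz : z ∈ F) (hyx : y ≠ x) (hzx : z ≠ x)
    (h1 : boundary P A r x y) (h2 : boundary P A r x z) : y = z := by
  refine boundary_eq hP (Setoid.trans' _ (Setoid.symm' _ h1) h2) (h.sub y hy) (h.sub z hz) ?_
  have a := h.snd_ne hP hx hy h1 hyx
  have b := h.snd_ne hP hx hz h2 hzx
  revert a b
  cases x.2 <;> cases y.2 <;> cases z.2 <;> simp

/-- Partners for the boundary relation are unique on `F`, so inclusion together with existence of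
partners for `N` already forces equality on `F`. Off `F`, `N` still records the ends already glued,
including the closed loops. -/
theorem iff (hP : Function.Injective P) (h : IsBoundaryOn P F A r N) {x y : X × Bool}
    (hx : x ∈ F) (hy : y ∈ F) : N x y ↔ boundary P A r x y := by
  refine ⟨h.le x hx y hy, fun hxy => ?_⟩
  by_cases hne : y = x
  · exact hne ▸ N.refl' _
  obtain ⟨z, hz, hzx, hxz⟩ := h.ex x hx
  rw [h.boundary_uniq hP hx hy hz hne hzx hxy (h.le x hx z hz hxz)]
  exact hxz

theorem uniq (hP : Function.Injective P) (h : IsBoundaryOn P F A r N) :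
    ∀ x ∈ F, ∀ y ∈ F, ∀ z ∈ F, y ≠ x → z ≠ x → N x y → N x z → y = z :=
  fun x hx y hy z hz hyx hzx h1 h2 =>
    h.boundary_uniq hP hx hy hz hyx hzx (h.le x hx y hy h1) (h.le x hx z hz h2)

variable {p q : X}

/-- Joining the neighbouring points `p` and `q`: the inner sides. -/
theorem join_inner (hP : Function.Injective P) (h : IsBoundaryOn P F A r N)
    (hp : (p, true) ∈ F) (hq : (q, false) ∈ F) (hpq : P p < P q)
    (hadj : ∀ u ∈ A, ¬ (P p < P u ∧ P u < P q)) :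
    IsBoundaryOn P (F \ {(p, true), (q, false)}) A (addPair r p q)
      (addPair N (p, true) (q, false)) := by
  have hpA := h.sub _ hp
  have hqA := h.sub _ hq
  dsimp only at hpA hqA
  have mem : ∀ {x}, x ∈ F \ {(p, true), (q, false)} ↔
      x ∈ F ∧ x ≠ (p, true) ∧ x ≠ (q, false) := by simp [not_or]
  refine ⟨fun x hx => h.sub x hx.1, ?_, ?_⟩
  -- The only doubled points between `p` and `q` are the two ends being removed. Every other chord
  -- therefore has `p` and `q` on the same side, and merging their blocks creates no new
  -- obstruction.
  · have side : ∀ x, x ≠ (p, true) → x ≠ (q, false) → x.1 ∈ A →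
        ((2 * P x.1 + x.2.toNat ≤ 2 * P p) ↔ (2 * P x.1 + x.2.toNat ≤ 2 * P q)) := by
      rintro ⟨x, c⟩ h1 h2 hx
      have h3 := hadj x hx
      by_cases hxp : x = p
      · subst hxp
        cases c
        · simp; omega
        · exact absurd rfl h1
      by_cases hxq : x = q
      · subst hxq
        cases c
        · exact absurd rfl h2
        · simp; omega
      have h4 : P x ≠ P p := fun e => hxp (hP e)
      have h5 : P x ≠ P q := fun e => hxq (hP e)
      cases c <;> simp <;> omega
    -- No point of `A` lies between the two joined ends, so chords passing through them concatenate.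
    have close : ∀ u ∈ A, ((2 * P p + 1 ≤ 2 * P u) ↔ (2 * P q ≤ 2 * P u)) := fun u hu => by
      have := hadj u hu
      omega
    rintro x hx y hy hxy
    obtain ⟨hx, hx1, hx2⟩ := mem.1 hx
    obtain ⟨hy, hy1, hy2⟩ := mem.1 hy
    have key : addPair r p q x.1 y.1 ∧ ∀ u ∈ A, ∀ v ∈ A, r u v →
        (((2 * P x.1 + x.2.toNat ≤ 2 * P u) ↔ (2 * P y.1 + y.2.toNat ≤ 2 * P u)) ↔
        ((2 * P x.1 + x.2.toNat ≤ 2 * P v) ↔ (2 * P y.1 + y.2.toNat ≤ 2 * P v))) := by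
      rcases hxy with k | ⟨k, k'⟩ | ⟨k, k'⟩
      · have := h.le x hx y hy k
        exact ⟨Or.inl this.1, this.2⟩
      · have a := h.le _ hx _ hp k
        have b := h.le _ hq _ hy k'
        refine ⟨Or.inr (Or.inl ⟨a.1, b.1⟩), fun u hu v hv huv => ?_⟩
        have a' := a.2 u hu v hv huv
        have b' := b.2 u hu v hv huv
        have c1 := close u hu
        have c2 := close v hv
        exact iff_iff_trans a' b' c1 c2
      · have a := h.le _ hx _ hq k
        have b := h.le _ hp _ hy k'
        refine ⟨Or.inr (Or.inr ⟨a.1, b.1⟩), fun u hu v hv huv => ?_⟩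
        have a' := a.2 u hu v hv huv
        have b' := b.2 u hu v hv huv
        have c1 := close u hu
        have c2 := close v hv
        exact iff_iff_trans a' b' c1.symm c2.symm
    refine ⟨key.1, fun u hu v hv huv => ?_⟩
    have s1 := side x hx1 hx2 (h.sub x hx)
    have s2 := side y hy1 hy2 (h.sub y hy)
    rcases huv with k | ⟨k, k'⟩ | ⟨k, k'⟩
    · exact key.2 u hu v hv k
    · have a := key.2 u hu p hpA k
      have b := key.2 q hqA v hv k'
      exact iff_iff_trans' a b s1 s2
    · have a := key.2 u hu q hqA k
      have b := key.2 p hpA v hv k'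
      exact iff_iff_trans' a b s1.symm s2.symm
  · rintro x hx
    obtain ⟨hx, hx1, hx2⟩ := mem.1 hx
    obtain ⟨y, hy, y1, y2, hyx, hxy⟩ :=
      exists_partner_addPair h.ex (h.uniq hP) hp hq (by simp) hx hx1 hx2
    exact ⟨y, mem.2 ⟨hy, y1, y2⟩, hyx, hxy⟩

/-- Joining the neighbouring points `p` and `q`: the outer sides. -/
theorem join_outer (hP : Function.Injective P) (h : IsBoundaryOn P F A r N)
    (hp : (p, false) ∈ F) (hq : (q, true) ∈ F) (hpq : P p < P q) (hr : r p q)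
    (hadj : ∀ u ∈ A, ¬ (P p < P u ∧ P u < P q))
    (hF : ∀ x ∈ F, x ≠ (p, false) → x ≠ (q, true) → x.1 ≠ p ∧ x.1 ≠ q) :
    IsBoundaryOn P (F \ {(p, false), (q, true)}) (A \ {p, q}) r
      (addPair N (p, false) (q, true)) := by
  have mem : ∀ {x}, x ∈ F \ {(p, false), (q, true)} ↔
      x ∈ F ∧ x ≠ (p, false) ∧ x ≠ (q, true) := by simp [not_or]
  have memA : ∀ {x}, x ∈ A \ {p, q} ↔ x ∈ A ∧ x ≠ p ∧ x ≠ q := by simp [not_or]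
  refine ⟨fun x hx => ?_, ?_, ?_⟩
  · obtain ⟨hx, h1, h2⟩ := mem.1 hx
    exact memA.2 ⟨h.sub x hx, hF x hx h1 h2⟩
  -- Between the two outer ends lie only `p` and `q` themselves; this is why they leave `A` at this
  -- stage.
  · have close : ∀ u ∈ A \ {p, q}, ((2 * P p ≤ 2 * P u) ↔ (2 * P q + 1 ≤ 2 * P u)) :=
      fun u hu => by
        obtain ⟨hu, h1, h2⟩ := memA.1 hu
        have := hadj u hu
        have h4 : P u ≠ P p := fun e => h1 (hP e)
        have h5 : P u ≠ P q := fun e => h2 (hP e)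
        omega
    rintro x hx y hy hxy
    obtain ⟨hx, hx1, hx2⟩ := mem.1 hx
    obtain ⟨hy, hy1, hy2⟩ := mem.1 hy
    rcases hxy with k | ⟨k, k'⟩ | ⟨k, k'⟩
    · have := h.le x hx y hy k
      exact ⟨this.1, fun u hu v hv huv => this.2 u hu.1 v hv.1 huv⟩
    · have a := h.le _ hx _ hp k
      have b := h.le _ hq _ hy k'
      refine ⟨r.trans' a.1 (r.trans' hr b.1), fun u hu v hv huv => ?_⟩
      have a' := a.2 u hu.1 v hv.1 huv
      have b' := b.2 u hu.1 v hv.1 huv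
      have c1 := close u hu
      have c2 := close v hv
      exact iff_iff_trans a' b' c1 c2
    · have a := h.le _ hx _ hq k
      have b := h.le _ hp _ hy k'
      refine ⟨r.trans' a.1 (r.trans' (r.symm' hr) b.1), fun u hu v hv huv => ?_⟩
      have a' := a.2 u hu.1 v hv.1 huv
      have b' := b.2 u hu.1 v hv.1 huv
      have c1 := close u hu
      have c2 := close v hv
      exact iff_iff_trans a' b' c1.symm c2.symm
  · rintro x hx
    obtain ⟨hx, hx1, hx2⟩ := mem.1 hx
    obtain ⟨y, hy, y1, y2, hyx, hxy⟩ :=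
      exists_partner_addPair h.ex (h.uniq hP) hp hq (by simp) hx hx1 hx2
    exact ⟨y, mem.2 ⟨hy, y1, y2⟩, hyx, hxy⟩

end IsBoundaryOn

/-- The points on the two sides of the points of `A`. -/
def sides (A : Set X) : Set (X × Bool) := {x | x.1 ∈ A}

/-- The boundary after gluing `p` to `q`. -/
def glueBoundary (N : Setoid (X × Bool)) (p q : X) : Setoid (X × Bool) :=
  addPair (addPair N (p, true) (q, false)) (p, false) (q, true)

/-- Gluing the neighbouring points `p` and `q` glues the boundary, and the numbers of components
change accordingly. -/
theorem IsBoundaryOn.glue [Finite X] {P : X → ℕ} (hP : Function.Injective P) {A : Set X}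
    {r : Setoid X} {N : Setoid (X × Bool)} (h : IsBoundaryOn P (sides A) A r N) {p q : X}
    (hp : p ∈ A) (hq : q ∈ A) (hpq : P p < P q) (hadj : ∀ u ∈ A, ¬ (P p < P u ∧ P u < P q)) :
    IsBoundaryOn P (sides (A \ {p, q})) (A \ {p, q}) (addPair r p q) (glueBoundary N p q) ∧
      numBlocks (glueBoundary N p q) Set.univ + 1 + numBlocks (addPair r p q) (A \ {p, q}) +
          2 * numBlocks r Set.univ =
        numBlocks N Set.univ + numBlocks r A + 2 * numBlocks (addPair r p q) Set.univ := by
  classical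
  have hne : p ≠ q := fun e => by subst e; exact lt_irrefl _ hpq
  have h1 := h.join_inner hP (p := p) (q := q) hp hq hpq hadj
  have hpF : (p, false) ∈ sides A \ {(p, true), (q, false)} :=
    ⟨hp, by simp [hne]⟩
  have hqF : (q, true) ∈ sides A \ {(p, true), (q, false)} :=
    ⟨hq, by simp [hne.symm]⟩
  have hF : ∀ x ∈ sides A \ {(p, true), (q, false)}, x ≠ (p, false) → x ≠ (q, true) →
      x.1 ≠ p ∧ x.1 ≠ q := by
    rintro ⟨x, c⟩ ⟨_, hx⟩ hx1 hx2
    simp only [Set.mem_insert_iff, Set.mem_singleton_iff, not_or] at hx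
    constructor
    · rintro rfl
      cases c
      · exact hx1 rfl
      · exact hx.1 rfl
    · rintro rfl
      cases c
      · exact hx.2 rfl
      · exact hx2 rfl
  have h2 := h1.join_outer hP hpF hqF hpq (addPair_self r p q) hadj hF
  have hset : (sides A \ {(p, true), (q, false)}) \ {(p, false), (q, true)} =
      sides (A \ {p, q}) := by
    ext ⟨x, c⟩
    constructor
    · rintro ⟨hx, hx'⟩
      simp only [Set.mem_insert_iff, Set.mem_singleton_iff, not_or] at hx'
      exact ⟨hx.1, by simpa using hF _ hx hx'.1 hx'.2⟩
    · rintro ⟨hx, hx'⟩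
      simp only [Set.mem_insert_iff, Set.mem_singleton_iff, not_or] at hx'
      exact ⟨⟨hx, by simp [hx'.1, hx'.2]⟩, by simp [hx'.1, hx'.2]⟩
  rw [hset] at h2
  refine ⟨h2, ?_⟩
  -- The inner join closes a loop exactly when `p` and `q` already lie in one block, so that gluing
  -- them encloses a hole.
  have inner : N (p, true) (q, false) ↔ r p q := by
    rw [h.iff hP hp hq]
    refine ⟨fun k => k.1, fun k => ⟨k, fun u hu v hv _ => ?_⟩⟩
    have a := hadj u hu
    have b := hadj v hv
    simp only [Bool.toNat_true, Bool.toNat_false]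
    omega
  -- The outer join closes a loop exactly when the merged block has no remaining point, that is,
  -- when it becomes an internal component. The points between these two ends are exactly `p` and
  -- `q`, so the chord condition says that no other point of `A` shares their block.
  have outer : addPair N (p, true) (q, false) (p, false) (q, true) ↔
      ¬ ∃ u ∈ A \ {p, q}, addPair r p q u p := by
    have memA : ∀ {x}, x ∈ A \ {p, q} ↔ x ∈ A ∧ x ≠ p ∧ x ≠ q := by simp [not_or]
    rw [h1.iff hP hpF hqF]
    constructor
    · rintro ⟨_, k⟩ ⟨u, hu, hup⟩
      obtain ⟨hu, u1, u2⟩ := memA.1 hu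
      have a := k u hu p hp hup
      have b := hadj u hu
      have h4 : P u ≠ P p := fun e => u1 (hP e)
      have h5 : P u ≠ P q := fun e => u2 (hP e)
      simp only [Bool.toNat_true, Bool.toNat_false] at a
      omega
    · intro hn
      have key : ∀ u ∈ A, addPair r p q p u → u = p ∨ u = q := fun u hu k => by
        by_contra hc
        exact hn ⟨u, memA.2 ⟨hu, not_or.1 hc⟩, Setoid.symm' _ k⟩
      refine ⟨addPair_self r p q, fun u hu v hv huv => ?_⟩
      have hpq' := addPair_self r p q
      have part : ∀ u ∈ A, ∀ v ∈ A, addPair r p q u v → (u = p ∨ u = q) → (v = p ∨ v = q) := by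
        rintro u hu v hv huv (rfl | rfl)
        · exact key v hv huv
        · exact key v hv (Setoid.trans' _ hpq' huv)
      have val : ∀ u ∈ A, ((2 * P p ≤ 2 * P u ↔ 2 * P q + 1 ≤ 2 * P u) ↔ ¬ (u = p ∨ u = q)) := by
        intro u hu
        have b := hadj u hu
        by_cases e1 : u = p
        · subst e1; simp; omega
        by_cases e2 : u = q
        · subst e2; simp; omega
        have h4 : P u ≠ P p := fun e => e1 (hP e)
        have h5 : P u ≠ P q := fun e => e2 (hP e)
        simp only [e1, e2, or_self, not_false_iff, iff_true]
        omega
      have a := part u hu v hv huv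
      have b := part v hv u hu (Setoid.symm' _ huv)
      have c := val u hu
      have d := val v hv
      exact c.trans ((not_congr ⟨a, b⟩).trans d.symm)
  have e1 := numBlocks_addPair (r := N) (A := Set.univ) (p := (p, true)) (q := (q, false))
    (Set.mem_univ _) (Set.mem_univ _)
  have e2 := numBlocks_addPair (r := addPair N (p, true) (q, false)) (A := Set.univ)
    (p := (p, false)) (q := (q, true)) (Set.mem_univ _) (Set.mem_univ _)
  have e3 := numBlocks_addPair (r := r) (A := Set.univ) (p := p) (q := q)
    (Set.mem_univ _) (Set.mem_univ _)
  have e4 := numBlocks_addPair (r := r) (A := A) (p := p) (q := q) hp hq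
  have e5 := numBlocks_remove (r := addPair r p q) (A := A) (B := A \ {p, q}) hp
    Set.sdiff_subset fun u hu hu' => by
      have : u = p ∨ u = q := by
        by_contra hc
        exact hu' ⟨hu, by simpa using hc⟩
      rcases this with rfl | rfl
      · exact Setoid.refl' _ _
      · exact Setoid.symm' _ (addPair_self r p u)
  change numBlocks (addPair (addPair N (p, true) (q, false)) (p, false) (q, true)) Set.univ
    + 1 + _ + _ = _
  -- When `p` and `q` lie in different blocks, the components of `N`, the blocks meeting `A` and all
  -- the blocks each drop by one. In addition, either `N` drops by one or a block stops meeting the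
  -- remaining points. Thus N + (blocks meeting the remaining points) - 2 (blocks) always drops by
  -- one.
  by_cases c1 : r p q <;> by_cases c2 : ∃ u ∈ A \ {p, q}, addPair r p q u p <;>
    simp only [inner, outer, c1, c2, if_true, if_false, not_true, not_false_iff] at e1 e2 e3 e4 e5 <;>
    omega

end Contraction

/-! ### Juxtaposed partitions, partitions described by universal properties, and the number of
strands. -/

section DirectSum

variable {X Y Z : Type}

/-- Two partitions side by side. -/
def sideBySide (a : Setoid X) (b : Setoid Y) : Setoid (X ⊕ Y) where
  r x y := match x, y with
    | Sum.inl x, Sum.inl y => a x y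
    | Sum.inr x, Sum.inr y => b x y
    | _, _ => False
  iseqv := by
    refine ⟨?_, ?_, ?_⟩
    · rintro (x | x)
      exacts [a.refl' x, b.refl' x]
    · rintro (x | x) (y | y) h
      exacts [a.symm' h, h, h, b.symm' h]
    · rintro (x | x) (y | y) (z | z) h k <;> first | exact h.elim | exact k.elim | skip
      exacts [a.trans' h k, b.trans' h k]

theorem sideBySide_le {a : Setoid X} {b : Setoid Y} {s : Setoid (X ⊕ Y)} :
    sideBySide a b ≤ s ↔ a ≤ s.comap Sum.inl ∧ b ≤ s.comap Sum.inr := by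
  refine ⟨fun h => ⟨fun x y k => ?_, fun x y k => ?_⟩, fun h => ?_⟩
  · exact @h (Sum.inl x) (Sum.inl y) k
  · exact @h (Sum.inr x) (Sum.inr y) k
  · rintro (x | x) (y | y) k
    exacts [h.1 k, k.elim, k.elim, h.2 k]

theorem numBlocks_sideBySide [Finite X] [Finite Y] (a : Setoid X) (b : Setoid Y) :
    numBlocks (sideBySide a b) Set.univ = numBlocks a Set.univ + numBlocks b Set.univ := by
  have h1 := numBlocks_image (r := sideBySide a b) (s := a) (A := Set.univ) Sum.inl
    fun _ _ _ _ => Iff.rfl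
  have h2 := numBlocks_image (r := sideBySide a b) (s := b) (A := Set.univ) Sum.inr
    fun _ _ _ _ => Iff.rfl
  rw [← h1, ← h2]
  unfold numBlocks
  rw [← Set.ncard_union_eq ?_ (Set.toFinite _) (Set.toFinite _), ← Set.image_union]
  · congr 2
    ext (x | x) <;> simp
  · rw [Set.disjoint_left]
    rintro _ ⟨_, ⟨x, -, rfl⟩, rfl⟩ ⟨_, ⟨y, -, rfl⟩, h⟩
    exact (block_eq.1 h : False)

/-- Identifying points of a partition along a map. -/
theorem eq_comap_of_universal {r R : Setoid X} {T : Setoid Z} {θ : X → Z}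
    (hR : ∀ s, R ≤ s ↔ r ≤ s ∧ Setoid.ker θ ≤ s) (hT : ∀ s, T ≤ s ↔ r ≤ s.comap θ) :
    R = T.comap θ := by
  obtain ⟨h1, h2⟩ := (hR R).1 le_rfl
  refine le_antisymm ((hR _).2 ⟨(hT T).1 le_rfl, fun x y h => ?_⟩) fun x y h => ?_
  · have h' : θ x = θ y := h
    rw [Setoid.comap_rel, h']
  -- Since `R` contains the kernel of `θ`, its image is already an equivalence relation, with no
  -- transitive closure to take.
  · have hle : T ≤ R.map θ := (hT _).2 (h1.trans (map_le_iff.1 le_rfl))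
    have hm := hle h
    have hrel := congrFun (congrFun (Setoid.coe_map_of_ker_le R θ h2) (θ x)) (θ y)
    rcases (iff_of_eq hrel).1 hm with ⟨u, v, huv, hu, hv⟩ | e
    swap
    · exact h2 e
    exact R.trans' (h2 (show θ x = θ u from hu.symm)) (R.trans' huv (h2 (show θ v = θ y from hv)))

/-- Every strand has exactly one `true` end, so strands are indexed by the points of `A`. -/
theorem numBlocks_boundary [Finite X] {P : X → ℕ} (hP : Function.Injective P) {A : Set X}
    {r : Setoid X} {N : Setoid (X × Bool)} (h : IsBoundaryOn P (sides A) A r N) :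
    numBlocks N (sides A) = A.ncard := by
  have : block N '' sides A = (fun p => block N (p, true)) '' A := by
    ext s
    constructor
    · rintro ⟨⟨p, _ | _⟩, hp, rfl⟩
      · obtain ⟨⟨q, c⟩, hq, hne, hpq⟩ := h.ex _ hp
        have := h.snd_ne hP hp hq (h.le _ hp _ hq hpq) hne
        obtain rfl : c = true := by simpa using this
        exact ⟨q, hq, (block_eq.2 hpq).symm⟩
      · exact ⟨p, hp, rfl⟩
    · rintro ⟨p, hp, rfl⟩
      exact ⟨(p, true), hp, rfl⟩
  unfold numBlocks
  rw [this]
  refine Set.InjOn.ncard_image fun p hp q hq e => ?_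
  exact congrArg Prod.fst (boundary_eq hP (h.le (p, true) hp (q, true) hq (block_eq.1 e)) hp hq rfl)

end DirectSum

/-! ### Fattening, its compatibility with concatenation, and Euler's formula. -/

section Fatten

variable {n : ℕ}

theorem isBoundaryOn_univ {X : Type} [Finite X] {P : X → ℕ} (hP : Function.Injective P)
    {r : Setoid X} (hr : Noncrossing P r) :
    IsBoundaryOn P (sides Set.univ) Set.univ r (boundary P Set.univ r) :=
  ⟨fun _ _ => Set.mem_univ _, fun _ _ _ _ h => h, fun x _ => by
    obtain ⟨y, h1, h2⟩ := exists_boundary hP hr x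
    exact ⟨y, Set.mem_univ y.1, h1, h2⟩⟩

/-- The doubled points, in the order in which they appear on the boundary of the rectangle. -/
def double : (Fin n ⊕ Fin n) × Bool → Fin (2 * n) ⊕ Fin (2 * n)
  | (Sum.inl i, c) => Sum.inl ⟨2 * i + c.toNat, by have := c.toNat_le; omega⟩
  -- The bottom is read from right to left, so the end just before `i` is its right-hand copy. This
  -- makes `pos_double` uniform in the two rows.
  | (Sum.inr i, c) => Sum.inr ⟨2 * i + (!c).toNat, by have := (!c).toNat_le; omega⟩

theorem pos_lt (x : Fin n ⊕ Fin n) : pos x < 2 * n := by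
  rcases x with x | x <;> simp only [pos] <;> omega

theorem pos_double (x : (Fin n ⊕ Fin n) × Bool) : pos (double x) = 2 * pos x.1 + x.2.toNat := by
  rcases x with ⟨x | x, _ | _⟩ <;> simp [double, pos] <;> omega

theorem double_injective : Function.Injective (double (n := n)) := by
  intro x y h
  have h' := congrArg pos h
  rw [pos_double, pos_double] at h'
  rcases x with ⟨x, _ | _⟩ <;> rcases y with ⟨y, _ | _⟩ <;>
    simp only [Bool.toNat_true, Bool.toNat_false] at h'
  · exact Prod.ext (pos_injective (by dsimp only; omega)) rfl
  · omega
  · omega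
  · exact Prod.ext (pos_injective (by dsimp only; omega)) rfl

theorem double_surjective : Function.Surjective (double (n := n)) := by
  rintro (x | x)
  · rcases Nat.even_or_odd' x with ⟨k, hk | hk⟩
    · exact ⟨(Sum.inl ⟨k, by omega⟩, false), congrArg Sum.inl (Fin.ext (by simp [hk]))⟩
    · exact ⟨(Sum.inl ⟨k, by omega⟩, true), congrArg Sum.inl (Fin.ext (by simp [hk]))⟩
  · rcases Nat.even_or_odd' x with ⟨k, hk | hk⟩
    · exact ⟨(Sum.inr ⟨k, by omega⟩, true), congrArg Sum.inr (Fin.ext (by simp [hk]))⟩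
    · exact ⟨(Sum.inr ⟨k, by omega⟩, false), congrArg Sum.inr (Fin.ext (by simp [hk]))⟩

/-- Doubling, as a bijection. -/
noncomputable def doubleEquiv (n : ℕ) :
    (Fin n ⊕ Fin n) × Bool ≃ Fin (2 * n) ⊕ Fin (2 * n) :=
  Equiv.ofBijective double ⟨double_injective, double_surjective⟩

/-- The Temperley–Lieb diagram formed by the boundaries of the blocks of a planar partition. -/
noncomputable def fatten (a : Setoid (Fin n ⊕ Fin n)) : Setoid (Fin (2 * n) ⊕ Fin (2 * n)) :=
  (boundary pos Set.univ a).comap (doubleEquiv n).symm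

theorem fatten_double {a : Setoid (Fin n ⊕ Fin n)} {x y : (Fin n ⊕ Fin n) × Bool} :
    fatten a (double x) (double y) ↔ boundary pos Set.univ a x y := by
  have h : ∀ x, (doubleEquiv n).symm (double x) = x := (doubleEquiv n).symm_apply_apply
  rw [fatten, Setoid.comap_rel, h, h]

/-- The position of a point in the word formed by the boundary points of two diagrams. -/
def pos₂ : (Fin n ⊕ Fin n) ⊕ (Fin n ⊕ Fin n) → ℕ :=
  Sum.elim pos fun y => 2 * n + pos y

theorem pos₂_injective : Function.Injective (pos₂ (n := n)) := by
  rintro (x | x) (y | y) h <;> simp only [pos₂, Sum.elim_inl, Sum.elim_inr] at h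
  · exact congrArg _ (pos_injective h)
  · have := pos_lt x
    omega
  · have := pos_lt y
    omega
  · exact congrArg _ (pos_injective (by omega))

theorem noncrossing_sideBySide {a b : Setoid (Fin n ⊕ Fin n)} (ha : IsPlanar a)
    (hb : IsPlanar b) : Noncrossing pos₂ (sideBySide a b) := by
  rintro (w | w) (x | x) (y | y) (z | z) h1 h2 h3 h4 h5 <;>
    simp only [pos₂, Sum.elim_inl, Sum.elim_inr] at h1 h2 h3 <;>
    first | exact h4.elim | exact h5.elim | skip
  · exact ha w x y z h1 h2 h3 h4 h5
  · have := pos_lt y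
    omega
  · have := pos_lt x
    omega
  · exact hb w x y z (by omega) (by omega) (by omega) h4 h5

theorem boundary_sideBySide_inl {a b : Setoid (Fin n ⊕ Fin n)} {x y : Fin n ⊕ Fin n}
    {c d : Bool} : boundary pos₂ Set.univ (sideBySide a b) (Sum.inl x, c) (Sum.inl y, d) ↔
      boundary pos Set.univ a (x, c) (y, d) := by
  refine and_congr Iff.rfl ⟨fun h u _ v _ huv => h (Sum.inl u) trivial (Sum.inl v) trivial huv, ?_⟩
  rintro h (u | u) - (v | v) - huv
  · exact h u trivial v trivial huv
  · exact huv.elim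
  · exact huv.elim
  · have := pos_lt x
    have := pos_lt y
    simp only [pos₂, Sum.elim_inl, Sum.elim_inr]
    cases c <;> cases d <;> simp only [Bool.toNat_true, Bool.toNat_false] <;> omega

theorem boundary_sideBySide_inr {a b : Setoid (Fin n ⊕ Fin n)} {x y : Fin n ⊕ Fin n}
    {c d : Bool} : boundary pos₂ Set.univ (sideBySide a b) (Sum.inr x, c) (Sum.inr y, d) ↔
      boundary pos Set.univ b (x, c) (y, d) := by
  refine and_congr Iff.rfl ⟨fun h u _ v _ huv => ?_, ?_⟩
  · have := h (Sum.inr u) trivial (Sum.inr v) trivial huv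
    simp only [pos₂, Sum.elim_inr] at this ⊢
    omega
  rintro h (u | u) - (v | v) - huv
  · have := pos_lt u
    have := pos_lt v
    simp only [pos₂, Sum.elim_inl, Sum.elim_inr]
    omega
  · exact huv.elim
  · exact huv.elim
  · have := h u trivial v trivial huv
    simp only [pos₂, Sum.elim_inr] at this ⊢
    omega

/-- The middle point `i`, as a bottom point of the upper diagram. -/
def midUp (i : Fin n) : (Fin n ⊕ Fin n) ⊕ (Fin n ⊕ Fin n) := Sum.inl (Sum.inr i)

/-- The middle point `i`, as a top point of the lower diagram. -/
def midDown (i : Fin n) : (Fin n ⊕ Fin n) ⊕ (Fin n ⊕ Fin n) := Sum.inr (Sum.inl i)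

/-- The points that remain after gluing the first `j` pairs of middle points. -/
def unglued (n j : ℕ) : Set ((Fin n ⊕ Fin n) ⊕ (Fin n ⊕ Fin n)) :=
  {x | ∀ i : Fin n, (i : ℕ) < j → x ≠ midUp i ∧ x ≠ midDown i}

/-- Gluing the first `j` pairs of middle points, and the boundaries along with them. -/
theorem exists_glue {a b : Setoid (Fin n ⊕ Fin n)} (ha : IsPlanar a) (hb : IsPlanar b) (j : ℕ)
    (hj : j ≤ n) : ∃ R N,
      -- Universal properties forget the order of the gluings, so that the result can be compared
      -- with `stack`, where all middle points are glued at once.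
      (∀ s, R ≤ s ↔ sideBySide a b ≤ s ∧ ∀ i : Fin n, (i : ℕ) < j → s (midUp i) (midDown i)) ∧
      (∀ s, N ≤ s ↔ boundary pos₂ Set.univ (sideBySide a b) ≤ s ∧ ∀ i : Fin n, (i : ℕ) < j →
        s (midUp i, true) (midDown i, false) ∧ s (midUp i, false) (midDown i, true)) ∧
      IsBoundaryOn pos₂ (sides (unglued n j)) (unglued n j) R N ∧
      -- The invariant of `IsBoundaryOn.glue` summed over j gluings; at the start every point
      -- carries one strand.
      numBlocks N Set.univ + j + numBlocks R (unglued n j) +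
          2 * numBlocks (sideBySide a b) Set.univ =
        Nat.card ((Fin n ⊕ Fin n) ⊕ (Fin n ⊕ Fin n)) + numBlocks (sideBySide a b) Set.univ +
          2 * numBlocks R Set.univ := by
  induction j with
  | zero =>
    have h0 : unglued n 0 = Set.univ := Set.eq_univ_of_forall fun x i hi => absurd hi (by omega)
    have hB := isBoundaryOn_univ pos₂_injective (noncrossing_sideBySide ha hb)
    have hc := numBlocks_boundary pos₂_injective hB
    rw [show sides (Set.univ : Set ((Fin n ⊕ Fin n) ⊕ (Fin n ⊕ Fin n))) = Set.univ from
      Set.eq_univ_of_forall fun x => Set.mem_univ x.1, Set.ncard_univ] at hc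
    refine ⟨_, _, fun s => ?_, fun s => ?_, by rw [h0]; exact hB, by rw [h0, hc]; ring⟩
    · simp
    · simp
  | succ j ih =>
    obtain ⟨R, N, h1, h2, h3, h4⟩ := ih (by omega)
    let p : Fin n := ⟨j, by omega⟩
    have hp : midUp p ∈ unglued n j := fun i hi =>
      ⟨fun e => by
        have : p = i := Sum.inr_injective (Sum.inl_injective e)
        rw [← this] at hi
        exact lt_irrefl _ hi, by simp [midUp, midDown]⟩
    have hq : midDown p ∈ unglued n j := fun i hi =>
      ⟨by simp [midUp, midDown], fun e => by
        have : p = i := Sum.inl_injective (Sum.inr_injective e)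
        rw [← this] at hi
        exact lt_irrefl _ hi⟩
    have hpq : pos₂ (midUp p) < pos₂ (midDown p) := by
      simp only [pos₂, midUp, midDown, Sum.elim_inl, Sum.elim_inr, pos]
      omega
    -- The two copies of middle point `i` sit at positions 2n - 1 - i and 2n + i. These pairs are
    -- nested around the junction of the two words, so once the pairs below `j` are gone the pair
    -- `j` is adjacent.
    have hadj : ∀ u ∈ unglued n j,
        ¬ (pos₂ (midUp p) < pos₂ u ∧ pos₂ u < pos₂ (midDown p)) := by
      rintro ((u | u) | (u | u)) hu
      · simp only [pos₂, midUp, midDown, Sum.elim_inl, Sum.elim_inr, pos, p]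
        omega
      · have : ¬ (u : ℕ) < j := fun h => (hu u h).1 rfl
        simp only [pos₂, midUp, midDown, Sum.elim_inl, Sum.elim_inr, pos, p]
        omega
      · have : ¬ (u : ℕ) < j := fun h => (hu u h).2 rfl
        simp only [pos₂, midUp, midDown, Sum.elim_inl, Sum.elim_inr, pos, p]
        omega
      · simp only [pos₂, midUp, midDown, Sum.elim_inl, Sum.elim_inr, pos, p]
        omega
    have hset : unglued n j \ {midUp p, midDown p} = unglued n (j + 1) := by
      ext x
      constructor
      · rintro ⟨hx, hx'⟩ i hi
        simp only [Set.mem_insert_iff, Set.mem_singleton_iff, not_or] at hx'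
        by_cases hij : (i : ℕ) < j
        · exact hx i hij
        · obtain rfl : i = p := Fin.ext (by simp only [p]; omega)
          exact hx'
      · intro hx
        refine ⟨fun i hi => hx i (by omega), ?_⟩
        simp only [Set.mem_insert_iff, Set.mem_singleton_iff, not_or]
        exact hx p (by simp [p])
    obtain ⟨k1, k2⟩ := h3.glue pos₂_injective hp hq hpq hadj
    rw [hset] at k1 k2
    have step : ∀ Q : Fin n → Prop,
        (∀ i : Fin n, (i : ℕ) < j + 1 → Q i) ↔ (∀ i : Fin n, (i : ℕ) < j → Q i) ∧ Q p := by
      refine fun Q => ⟨fun h => ⟨fun i hi => h i (by omega), h p (by simp [p])⟩,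
        fun h i hi => ?_⟩
      by_cases hij : (i : ℕ) < j
      · exact h.1 i hij
      · obtain rfl : i = p := Fin.ext (by simp only [p]; omega)
        exact h.2
    refine ⟨_, _, fun s => ?_, fun s => ?_, k1, by omega⟩
    · rw [addPair_le, h1, step, and_assoc]
    · rw [glueBoundary, addPair_le, addPair_le, h2, step, and_assoc, and_assoc]

/-- A component of the glued picture either is internal or is the extension of exactly one block of
the composite. -/
theorem numBlocks_stack (a b : Setoid (Fin n ⊕ Fin n)) :
    numBlocks (stack a b) Set.univ = internal a b + numBlocks (comp a b) Set.univ := by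
  have h := numBlocks_image (r := stack a b) (s := comp a b) (A := Set.univ) outer
    fun _ _ _ _ => Iff.rfl
  rw [← h]
  unfold numBlocks internal
  rw [← Set.ncard_union_eq ?_ (Set.toFinite _) (Set.toFinite _)]
  · congr 1
    ext s
    constructor
    · rintro ⟨x, -, rfl⟩
      by_cases hx : ∃ y, stack a b (outer y) x
      · obtain ⟨y, hy⟩ := hx
        exact Or.inr ⟨_, ⟨y, trivial, rfl⟩, block_eq.2 hy⟩
      · exact Or.inl ⟨⟨x, rfl⟩, fun y hy => hx ⟨y, hy⟩⟩
    · rintro (⟨⟨x, rfl⟩, -⟩ | ⟨_, ⟨y, -, rfl⟩, rfl⟩)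
      · exact ⟨x, trivial, rfl⟩
      · exact ⟨_, trivial, rfl⟩
  · rw [Set.disjoint_left]
    rintro _ ⟨-, hs⟩ ⟨_, ⟨y, -, rfl⟩, rfl⟩
    exact hs y (Setoid.refl' (stack a b) (outer y))

/-- From two diagrams to the three layers of points. -/
def layer : (Fin n ⊕ Fin n) ⊕ (Fin n ⊕ Fin n) → Fin n ⊕ (Fin n ⊕ Fin n) :=
  Sum.elim upper lower

/-- From two diagrams with doubled points to the three layers of doubled points. -/
def layerDouble (x : ((Fin n ⊕ Fin n) ⊕ (Fin n ⊕ Fin n)) × Bool) :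
    Fin (2 * n) ⊕ (Fin (2 * n) ⊕ Fin (2 * n)) :=
  Sum.elim (fun y => upper (double (y, x.2))) (fun y => lower (double (y, x.2))) x.1

theorem ker_layer_le {s : Setoid ((Fin n ⊕ Fin n) ⊕ (Fin n ⊕ Fin n))} :
    Setoid.ker layer ≤ s ↔ ∀ i : Fin n, (i : ℕ) < n → s (midUp i) (midDown i) := by
  refine ⟨fun h i _ => h rfl, fun h => ?_⟩
  rintro ((x | x) | (x | x)) ((y | y) | (y | y)) hxy <;>
    simp [Setoid.ker_def, layer, upper, lower] at hxy <;> subst hxy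
  · exact s.refl' _
  · exact s.refl' _
  · exact h x x.2
  · exact s.symm' (h x x.2)
  · exact s.refl' _
  · exact s.refl' _

/-- The two copies of the middle row are read in opposite directions, so the side is reversed. Hence
`true` ends are glued to `false` ends, as in `glueBoundary`. -/
theorem layerDouble_mid (i : Fin n) (c : Bool) :
    layerDouble (midUp i, c) = layerDouble (midDown i, !c) := by
  cases c <;> rfl

theorem ker_layerDouble_le {s : Setoid (((Fin n ⊕ Fin n) ⊕ (Fin n ⊕ Fin n)) × Bool)} :
    Setoid.ker layerDouble ≤ s ↔ ∀ i : Fin n, (i : ℕ) < n →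
      s (midUp i, true) (midDown i, false) ∧ s (midUp i, false) (midDown i, true) := by
  refine ⟨fun h i _ => ⟨h (layerDouble_mid i true), h (layerDouble_mid i false)⟩, fun h => ?_⟩
  have h' : ∀ (i : Fin n) (c : Bool), s (midUp i, c) (midDown i, !c) := by
    rintro i (_ | _)
    exacts [(h i i.2).2, (h i i.2).1]
  have mixed : ∀ x y : Fin n ⊕ Fin n, ∀ c d : Bool,
      upper (double (x, c)) = (lower (double (y, d)) : Fin (2 * n) ⊕ (Fin (2 * n) ⊕ Fin (2 * n))) →
        s (Sum.inl x, c) (Sum.inr y, d) := by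
    rintro (x | x) (y | y) c d hxy <;> simp [upper, lower, double] at hxy
    have : (x : ℕ) = y ∧ d = !c := by
      revert hxy
      cases c <;> cases d <;> simp <;> omega
    obtain ⟨e1, rfl⟩ := this
    obtain rfl := Fin.ext e1
    exact h' x c
  rintro ⟨x | x, c⟩ ⟨y | y, d⟩ hxy
  · have := double_injective (upper_injective (show upper (double (x, c)) = upper (double (y, d))
      from hxy))
    simp only [Prod.mk.injEq] at this
    obtain ⟨rfl, rfl⟩ := this
    exact s.refl' _
  · exact mixed x y c d hxy
  · exact s.symm' (mixed y x d c (show _ = _ from hxy).symm)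
  · have := double_injective (lower_injective (show lower (double (x, c)) = lower (double (y, d))
      from hxy))
    simp only [Prod.mk.injEq] at this
    obtain ⟨rfl, rfl⟩ := this
    exact s.refl' _

theorem stack_le_iff {α β γ : Type} {a : Setoid (α ⊕ β)} {b : Setoid (β ⊕ γ)}
    {r : Setoid (α ⊕ (β ⊕ γ))} : stack a b ≤ r ↔ a ≤ r.comap upper ∧ b ≤ r.comap lower := by
  rw [stack, sup_le_iff, map_le_iff, map_le_iff]

theorem fatten_le {a : Setoid (Fin n ⊕ Fin n)} {s : Setoid (Fin (2 * n) ⊕ Fin (2 * n))} :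
    fatten a ≤ s ↔ boundary pos Set.univ a ≤ s.comap double := by
  refine ⟨fun h x y k => h (fatten_double.2 k), fun h x y k => ?_⟩
  obtain ⟨x, rfl⟩ := double_surjective x
  obtain ⟨y, rfl⟩ := double_surjective y
  exact h (fatten_double.1 k)

theorem stack_fatten_le {a b : Setoid (Fin n ⊕ Fin n)}
    {s : Setoid (Fin (2 * n) ⊕ (Fin (2 * n) ⊕ Fin (2 * n)))} :
    stack (fatten a) (fatten b) ≤ s ↔
      boundary pos₂ Set.univ (sideBySide a b) ≤ s.comap layerDouble := by
  rw [stack_le_iff, fatten_le, fatten_le]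
  constructor
  · rintro ⟨h1, h2⟩ ⟨x | x, c⟩ ⟨y | y, d⟩ h
    · exact h1 (boundary_sideBySide_inl.1 h)
    · exact h.1.elim
    · exact h.1.elim
    · exact h2 (boundary_sideBySide_inr.1 h)
  · intro h
    refine ⟨?_, ?_⟩
    · rintro ⟨x, c⟩ ⟨y, d⟩ k
      exact h (boundary_sideBySide_inl.2 k)
    · rintro ⟨x, c⟩ ⟨y, d⟩ k
      exact h (boundary_sideBySide_inr.2 k)

/-- The outer points among the points of two diagrams. -/
def outer₂ : Fin n ⊕ Fin n → (Fin n ⊕ Fin n) ⊕ (Fin n ⊕ Fin n) := Sum.map Sum.inl Sum.inr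

theorem layer_outer₂ (x : Fin n ⊕ Fin n) : layer (outer₂ x) = outer x := by
  rcases x with x | x <;> rfl

theorem layerDouble_outer₂ (x : Fin n ⊕ Fin n) (c : Bool) :
    layerDouble (outer₂ x, c) = outer (double (x, c)) := by
  rcases x with x | x <;> rfl

theorem image_outer₂ : outer₂ '' (Set.univ : Set (Fin n ⊕ Fin n)) = unglued n n := by
  ext ((x | x) | (x | x))
  · exact ⟨fun _ i _ => by simp [midUp, midDown], fun _ => ⟨Sum.inl x, trivial, rfl⟩⟩
  · refine ⟨?_, fun h => absurd rfl (h x x.2).1⟩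
    rintro ⟨y | y, -, h⟩ <;> simp [outer₂] at h
  · refine ⟨?_, fun h => absurd rfl (h x x.2).2⟩
    rintro ⟨y | y, -, h⟩ <;> simp [outer₂] at h
  · exact ⟨fun _ i _ => by simp [midUp, midDown], fun _ => ⟨Sum.inr x, trivial, rfl⟩⟩

/-- The outer points occur in the long word in the same order as on the boundary of the composite,
so the chord conditions correspond. -/
theorem pos₂_outer₂_le (x u : Fin n ⊕ Fin n) (c : Bool) :
    2 * pos₂ (outer₂ x) + c.toNat ≤ 2 * pos₂ (outer₂ u) ↔ 2 * pos x + c.toNat ≤ 2 * pos u := by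
  rcases x with x | x <;> rcases u with u | u <;> cases c <;>
    simp only [pos₂, outer₂, Sum.map_inl, Sum.map_inr, Sum.elim_inl, Sum.elim_inr, pos,
      Bool.toNat_true, Bool.toNat_false] <;> omega

theorem layer_surjective : Function.Surjective (layer (n := n)) := by
  rintro (x | x | x)
  exacts [⟨Sum.inl (Sum.inl x), rfl⟩, ⟨Sum.inl (Sum.inr x), rfl⟩, ⟨Sum.inr (Sum.inr x), rfl⟩]

theorem layerDouble_surjective : Function.Surjective (layerDouble (n := n)) := by
  have hu : ∀ y, ∃ x, layerDouble (n := n) x = upper y := fun y => by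
    obtain ⟨⟨x, c⟩, rfl⟩ := double_surjective y
    exact ⟨(Sum.inl x, c), rfl⟩
  have hl : ∀ y, ∃ x, layerDouble (n := n) x = lower y := fun y => by
    obtain ⟨⟨x, c⟩, rfl⟩ := double_surjective y
    exact ⟨(Sum.inr x, c), rfl⟩
  rintro (x | x)
  exacts [hu (Sum.inl x), hl x]

theorem numBlocks_of_surjective {X Z : Type} {T : Setoid Z} {θ : X → Z}
    (hθ : Function.Surjective θ) : numBlocks (T.comap θ) Set.univ = numBlocks T Set.univ := by
  rw [← numBlocks_image (r := T) (s := T.comap θ) (A := Set.univ) θ fun _ _ _ _ => Iff.rfl,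
    Set.image_univ, hθ.range_eq]

theorem numBlocks_fatten {a : Setoid (Fin n ⊕ Fin n)} (ha : IsPlanar a) :
    numBlocks (fatten a) Set.univ = 2 * n := by
  rw [fatten, numBlocks_of_surjective (doubleEquiv n).symm.surjective]
  have := numBlocks_boundary pos_injective (isBoundaryOn_univ pos_injective ha)
  rw [show sides (Set.univ : Set (Fin n ⊕ Fin n)) = Set.univ from
      Set.eq_univ_of_forall fun x => Set.mem_univ x.1, Set.ncard_univ] at this
  rw [this]
  simp
  ring

/-- Fattening is compatible with concatenation, and the number of closed loops of the boundary is
determined by Euler's formula. -/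
theorem comp_fatten_and_internal_fatten {a b : Setoid (Fin n ⊕ Fin n)} (ha : IsPlanar a)
    (hb : IsPlanar b) :
    comp (fatten a) (fatten b) = fatten (comp a b) ∧
      internal (fatten a) (fatten b) + numBlocks a Set.univ + numBlocks b Set.univ =
        n + 2 * internal a b + numBlocks (comp a b) Set.univ := by
  obtain ⟨R, N, h1, h2, h3, h4⟩ := exists_glue ha hb n le_rfl
  -- Both sides are the partition generated by the two diagrams and the identification of the middle
  -- points; `hN` is the same statement for the boundaries.
  have hR : R = (stack a b).comap layer := eq_comap_of_universal (r := sideBySide a b)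
    (fun s => by rw [h1, ker_layer_le]) (fun s => by
      rw [stack_le_iff, sideBySide_le]; rfl)
  have hN : N = (stack (fatten a) (fatten b)).comap layerDouble := eq_comap_of_universal
    (fun s => by rw [h2, ker_layerDouble_le]) (fun s => stack_fatten_le)
  have hRo : ∀ u v, R (outer₂ u) (outer₂ v) ↔ comp a b u v := fun u v => by
    rw [hR, Setoid.comap_rel, layer_outer₂, layer_outer₂]; rfl
  have hmem : ∀ u, outer₂ u ∈ unglued n n := fun u => image_outer₂ ▸ ⟨u, trivial, rfl⟩
  -- After all n gluings the free ends are those of the outer points. There `N` is the boundary of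
  -- `R`, which restricts to the composite.
  have hcomp : comp (fatten a) (fatten b) = fatten (comp a b) := by
    refine Setoid.ext fun x y => ?_
    obtain ⟨⟨x, c⟩, rfl⟩ := double_surjective x
    obtain ⟨⟨y, d⟩, rfl⟩ := double_surjective y
    rw [fatten_double]
    have : comp (fatten a) (fatten b) (double (x, c)) (double (y, d)) ↔
        N (outer₂ x, c) (outer₂ y, d) := by
      rw [hN]
      change stack _ _ (outer _) (outer _) ↔ stack _ _ (layerDouble _) (layerDouble _)
      rw [layerDouble_outer₂, layerDouble_outer₂]
    rw [this, h3.iff pos₂_injective (hmem x) (hmem y)]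
    refine and_congr (hRo x y) ?_
    rw [← image_outer₂]
    simp only [Set.forall_mem_image, pos₂_outer₂_le, hRo]
  refine ⟨hcomp, ?_⟩
  have e1 := numBlocks_of_surjective (T := stack a b) layer_surjective
  have e2 := numBlocks_of_surjective (T := stack (fatten a) (fatten b)) layerDouble_surjective
  rw [← hR, numBlocks_stack] at e1
  rw [← hN, numBlocks_stack, hcomp, numBlocks_fatten (ha.comp hb)] at e2
  have e3 := numBlocks_image (r := R) (s := comp a b) (A := Set.univ) outer₂
    fun u _ v _ => (hRo u v).symm
  rw [image_outer₂] at e3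
  have e4 : Nat.card ((Fin n ⊕ Fin n) ⊕ (Fin n ⊕ Fin n)) = 4 * n := by
    simp
    ring
  -- With L loops this reads (L + 2n) + n + |ab| + 2(|a| + |b|) = 4n + |a| + |b| + 2(Φ + |ab|).
  rw [numBlocks_sideBySide, e1, e2, e3, e4] at h4
  omega

end Fatten

/-! ### Fattening as a bijection onto planar matchings, through strands, and regularity. -/

section Correspondence

variable {n : ℕ}

theorem isMatching_of_partner {r : Setoid (Fin n ⊕ Fin n)} (ex : ∀ x, ∃ y, y ≠ x ∧ r x y)
    (uniq : ∀ x y z, y ≠ x → z ≠ x → r x y → r x z → y = z) : IsMatching r := by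
  rintro _ ⟨x, rfl⟩
  obtain ⟨y, hyx, hxy⟩ := ex x
  rw [Set.ncard_eq_two]
  refine ⟨x, y, hyx.symm, Set.ext fun z => ⟨fun hz => ?_, ?_⟩⟩
  · by_cases hzx : z = x
    · exact Or.inl hzx
    · exact Or.inr (uniq x z y hzx hyx (r.symm' hz) hxy)
  · rintro (rfl | rfl)
    exacts [r.refl' z, r.symm' hxy]

theorem IsMatching.eq_of_le {r s : Setoid (Fin n ⊕ Fin n)} (hr : IsMatching r)
    (hs : IsMatching s) (h : r ≤ s) : r = s := by
  obtain ⟨σ, hσ, -, hσr⟩ := hr.exists_partner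
  obtain ⟨τ, -, -, hτr⟩ := hs.exists_partner
  have : σ = τ := funext fun x =>
    ((hτr x (σ x)).1 (h ((hσr x _).2 (Or.inr rfl)))).resolve_left (hσ x)
  refine Setoid.ext fun x y => ?_
  rw [hσr, hτr, this]

theorem isMatching_fatten {a : Setoid (Fin n ⊕ Fin n)} (ha : IsPlanar a) :
    IsMatching (fatten a) := by
  have hB := isBoundaryOn_univ pos_injective ha
  refine isMatching_of_partner (fun x => ?_) (fun x y z hy hz h1 h2 => ?_)
  · obtain ⟨x, rfl⟩ := double_surjective x
    obtain ⟨y, hy, h⟩ := exists_boundary pos_injective ha x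
    exact ⟨double y, fun e => hy (double_injective e), fatten_double.2 h⟩
  · obtain ⟨x, rfl⟩ := double_surjective x
    obtain ⟨y, rfl⟩ := double_surjective y
    obtain ⟨z, rfl⟩ := double_surjective z
    exact congrArg double (hB.boundary_uniq pos_injective (Set.mem_univ x.1) (Set.mem_univ y.1)
      (Set.mem_univ z.1) (fun e => hy (e ▸ rfl)) (fun e => hz (e ▸ rfl)) (fatten_double.1 h1)
      (fatten_double.1 h2))

/-- If two strands crossed, the first would separate the end points of the second, which lie in one
block of `a`; the definition of `boundary` forbids this. -/
theorem isPlanar_fatten (a : Setoid (Fin n ⊕ Fin n)) : IsPlanar (fatten a) := by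
  intro w x y z h1 h2 h3 hwy hxz
  obtain ⟨w, rfl⟩ := double_surjective w
  obtain ⟨x, rfl⟩ := double_surjective x
  obtain ⟨y, rfl⟩ := double_surjective y
  obtain ⟨z, rfl⟩ := double_surjective z
  exfalso
  rw [pos_double, pos_double] at h1 h2 h3
  have k1 := (fatten_double.1 hwy).2 x.1 trivial z.1 trivial (fatten_double.1 hxz).1
  have c1 := w.2.toNat_le
  have c2 := x.2.toNat_le
  have c3 := y.2.toNat_le
  have c4 := z.2.toNat_le
  omega

/-! ### Recovering a partition from its boundary -/

section Recover

variable {X : Type} {P : X → ℕ} {r : Setoid X}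

theorem boundary_next {p q v : X} (h : boundary P Set.univ r (p, true) (q, false))
    (hv : r p v) (hpv : P p < P v) : P p < P q ∧ P q ≤ P v := by
  have := h.2 p trivial v trivial hv
  simp only [Bool.toNat_true, Bool.toNat_false] at this
  omega

/-- A block is the chain of its successive points, and each link is a strand from a `true` end to a
`false` end. The induction is on the distance between two points of a block. -/
theorem le_of_boundary_le (hP : Function.Injective P)
    (ex : ∀ p, ∃ q, boundary P Set.univ r (p, true) (q, false)) {s : Setoid X}
    (hs : ∀ p q, boundary P Set.univ r (p, true) (q, false) → s p q) : r ≤ s := by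
  have key : ∀ d u v, P v - P u = d → r u v → P u < P v → s u v := by
    intro d
    induction d using Nat.strong_induction_on with
    | _ d ih =>
      intro u v hd huv hlt
      obtain ⟨q, hq⟩ := ex u
      obtain ⟨h1, h2⟩ := boundary_next hq huv hlt
      rcases h2.lt_or_eq with h3 | h3
      · exact s.trans' (hs _ _ hq)
          (ih (P v - P q) (by omega) q v rfl (r.trans' (r.symm' hq.1) huv) h3)
      · rw [← hP h3]
        exact hs _ _ hq
  intro u v huv
  rcases lt_trichotomy (P u) (P v) with h | h | h
  · exact key _ u v rfl huv h
  · rw [hP h]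
  · exact s.symm' (key _ v u rfl (r.symm' huv) h)

/-- If two blocks interleave as w < x < y < z, take the last point of the block of `w` before `x`.
The strand leaving it jumps over `x` and lands no later than `y`, so it separates `x` from `z`. -/
theorem noncrossing_of_exists_boundary [Finite X] (hP : Function.Injective P)
    (ex : ∀ p, ∃ q, boundary P Set.univ r (p, true) (q, false)) : Noncrossing P r := by
  intro w x y z h1 h2 h3 hwy hxz
  by_contra hn
  obtain ⟨p, ⟨hp1, hp2⟩, hmax⟩ := Set.exists_max_image {u | r w u ∧ P u < P x} P
    (Set.toFinite _) ⟨w, r.refl' w, h1⟩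
  obtain ⟨q, hq⟩ := ex p
  obtain ⟨h4, h5⟩ := boundary_next hq (r.trans' (r.symm' hp1) hwy) (hp2.trans h2)
  have hwq : r w q := r.trans' hp1 hq.1
  have h6 : ¬ P q < P x := fun h => absurd (hmax q ⟨hwq, h⟩) (by omega)
  have h7 : P q ≠ P x := fun h => hn (hP h ▸ hwq)
  have k := hq.2 x trivial z trivial hxz
  have k' := hq.2 p trivial q trivial hq.1
  simp only [Bool.toNat_true, Bool.toNat_false] at k k'
  omega

end Recover

theorem fatten_injective {a b : Setoid (Fin n ⊕ Fin n)} (ha : IsPlanar a) (hb : IsPlanar b)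
    (h : fatten a = fatten b) : a = b := by
  have aux : ∀ {a b : Setoid (Fin n ⊕ Fin n)}, IsPlanar a → fatten a = fatten b → a ≤ b :=
    fun {a b} ha h => le_of_boundary_le pos_injective (exists_boundary_true pos_injective ha)
      fun p q hpq => (fatten_double.1 (h ▸ fatten_double.2 hpq)).1
  exact le_antisymm (aux ha h) (aux hb h.symm)

/-! ### Every planar matching is a boundary -/

theorem IsPlanar.not_cross {r : Setoid (Fin n ⊕ Fin n)} (hr : IsPlanar r) {x y z w : Fin n ⊕ Fin n}
    (hxy : r x y) (hzw : r z w) (hn : ¬ r x z) :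
    (pos x < pos z ↔ pos y < pos z) ↔ (pos x < pos w ↔ pos y < pos w) := by
  have ne : ∀ {u v}, ¬ r u v → pos u ≠ pos v := fun h e => h (pos_injective e ▸ r.refl' _)
  have sy : ∀ {u v}, ¬ r u v → ¬ r v u := fun h h' => h (r.symm' h')
  have n1 : ¬ r x w := fun h => hn (r.trans' h (r.symm' hzw))
  have n2 : ¬ r y z := fun h => hn (r.trans' hxy h)
  have n3 : ¬ r y w := fun h => n1 (r.trans' hxy h)
  have c1 := ne hn
  have c2 := ne n1
  have c3 := ne n2
  have c4 := ne n3
  have hyx := r.symm' hxy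
  have hwz := r.symm' hzw
  have a1 : ¬ (pos x < pos z ∧ pos z < pos y ∧ pos y < pos w) :=
    fun ⟨p, q, s⟩ => hn (hr _ _ _ _ p q s hxy hzw)
  have a2 : ¬ (pos x < pos w ∧ pos w < pos y ∧ pos y < pos z) :=
    fun ⟨p, q, s⟩ => n1 (hr _ _ _ _ p q s hxy hwz)
  have a3 : ¬ (pos y < pos z ∧ pos z < pos x ∧ pos x < pos w) :=
    fun ⟨p, q, s⟩ => n2 (hr _ _ _ _ p q s hyx hzw)
  have a4 : ¬ (pos y < pos w ∧ pos w < pos x ∧ pos x < pos z) :=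
    fun ⟨p, q, s⟩ => n3 (hr _ _ _ _ p q s hyx hwz)
  have b1 : ¬ (pos z < pos x ∧ pos x < pos w ∧ pos w < pos y) :=
    fun ⟨p, q, s⟩ => sy hn (hr _ _ _ _ p q s hzw hxy)
  have b2 : ¬ (pos z < pos y ∧ pos y < pos w ∧ pos w < pos x) :=
    fun ⟨p, q, s⟩ => sy n2 (hr _ _ _ _ p q s hzw hyx)
  have b3 : ¬ (pos w < pos x ∧ pos x < pos z ∧ pos z < pos y) :=
    fun ⟨p, q, s⟩ => sy n1 (hr _ _ _ _ p q s hwz hxy)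
  have b4 : ¬ (pos w < pos y ∧ pos y < pos z ∧ pos z < pos x) :=
    fun ⟨p, q, s⟩ => sy n3 (hr _ _ _ _ p q s hwz hyx)
  omega

theorem exists_pos_eq {k : ℕ} (hk : k < 2 * n) : ∃ x : Fin n ⊕ Fin n, pos x = k := by
  by_cases h : k < n
  · exact ⟨Sum.inl ⟨k, h⟩, rfl⟩
  · exact ⟨Sum.inr ⟨2 * n - 1 - k, by omega⟩, by simp only [pos]; omega⟩

/-- By planarity the points strictly between two partners are matched among themselves, so their
number is even. In `exists_fatten_eq` this says that every strand joins a `true` end to a `false`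
end. -/
theorem odd_of_planar_matching {r : Setoid (Fin n ⊕ Fin n)} (hr : IsPlanar r)
    (hm : IsMatching r) {x y : Fin n ⊕ Fin n} (hxy : r x y) (hlt : pos x < pos y) :
    (pos x + pos y) % 2 = 1 := by
  classical
  obtain ⟨σ, -, -, hσ⟩ := hm.exists_partner
  have hyσ : y = σ x := ((hσ x y).1 hxy).resolve_left fun e => by subst e; exact lt_irrefl _ hlt
  have key : ∀ z w, r z w → pos x < pos z → pos z < pos y → pos x < pos w ∧ pos w < pos y := by
    intro z w hzw h1 h2
    have hn : ¬ r x z := fun h => by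
      rcases (hσ x z).1 h with rfl | e
      · exact lt_irrefl _ h1
      · rw [e, ← hyσ] at h2
        exact lt_irrefl _ h2
    have hn' : ¬ r y w := fun h => hn (r.trans' hxy (r.trans' h (r.symm' hzw)))
    have k := hr.not_cross hxy hzw hn
    have : pos y ≠ pos w := fun e => hn' (pos_injective e ▸ r.refl' _)
    omega
  have hsum := hm.sum_eq_zero (fun z => if pos x < pos z ∧ pos z < pos y then 1 else 0)
    fun z w hzw => by
      have : (pos x < pos z ∧ pos z < pos y) ↔ (pos x < pos w ∧ pos w < pos y) :=
        ⟨fun h => key z w hzw h.1 h.2, fun h => key w z (r.symm' hzw) h.1 h.2⟩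
      simp only [this]
  rw [Finset.sum_boole] at hsum
  have himg : (Finset.univ.filter fun z : Fin n ⊕ Fin n => pos x < pos z ∧ pos z < pos y).image pos
      = Finset.Ioo (pos x) (pos y) := by
    ext k
    simp only [Finset.mem_image, Finset.mem_filter, Finset.mem_univ, true_and, Finset.mem_Ioo]
    constructor
    · rintro ⟨z, hz, rfl⟩
      exact hz
    · intro hk
      obtain ⟨z, rfl⟩ := exists_pos_eq (n := n) (k := k) (hk.2.trans (pos_lt y))
      exact ⟨z, hk, rfl⟩
  have hcard := congrArg Finset.card himg
  rw [Finset.card_image_of_injective _ pos_injective, Nat.card_Ioo] at hcard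
  rw [hcard, ZMod.natCast_eq_zero_iff] at hsum
  omega

/-- The partition `a` is obtained by merging the two copies of each point, so its blocks are
generated by the strands of `s`. Every strand of `s` is a boundary chord of `a`, because noncrossing
chords separate no generating pair. This gives every point a successor, whence `a` is planar. The
matching `s` is then contained in the matching `fatten a`, so they agree. -/
theorem exists_fatten_eq {s : Setoid (Fin (2 * n) ⊕ Fin (2 * n))} (hs : IsPlanar s)
    (hm : IsMatching s) : ∃ a : Setoid (Fin n ⊕ Fin n), IsPlanar a ∧ fatten a = s := by
  let a : Setoid (Fin n ⊕ Fin n) := (s.comap double).map Prod.fst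
  obtain ⟨σ, hσ1, hσ2, hσ⟩ := hm.exists_partner
  have odd : ∀ x y, s (double x) (double y) → x ≠ y →
      (pos (double x) + pos (double y)) % 2 = 1 := by
    intro x y h hne
    have : pos (double x) ≠ pos (double y) := fun e => hne (double_injective (pos_injective e))
    rcases this.lt_or_gt with hlt | hlt
    · exact odd_of_planar_matching hs hm h hlt
    · rw [add_comm]
      exact odd_of_planar_matching hs hm (s.symm' h) hlt
  have hle : s.comap double ≤ boundary pos Set.univ a := by
    intro x y hxy
    have hxy : s (double x) (double y) := hxy
    refine ⟨Relation.EqvGen.rel _ _ ⟨x, y, hxy, rfl, rfl⟩, fun u _ v _ huv => ?_⟩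
    let E : Fin n ⊕ Fin n → Prop := fun u =>
      (2 * pos x.1 + x.2.toNat ≤ 2 * pos u ↔ 2 * pos y.1 + y.2.toNat ≤ 2 * pos u)
    suffices h : a ≤ Setoid.ker E from iff_of_eq (h huv)
    refine map_le_iff.2 fun z w hzw => ?_
    have hzw : s (double z) (double w) := hzw
    refine propext (show (_ ↔ _) ↔ (_ ↔ _) from ?_)
    by_cases hexy : x = y
    · subst hexy; simp
    by_cases hezw : z = w
    · subst hezw; rfl
    have o1 := odd x y hxy hexy
    have c1 := x.2.toNat_le
    have c2 := y.2.toNat_le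
    have c3 := z.2.toNat_le
    have c4 := w.2.toNat_le
    by_cases hxz : s (double x) (double z)
    -- The two strands coincide here, and the opposite parities of the ends ensure that the chord
    -- does not separate its own two points.
    · have hor : (z = x ∧ w = y) ∨ (z = y ∧ w = x) := by
        have h1 := (hσ _ _).1 hxz
        have h2 := ((hσ _ _).1 hzw).resolve_left fun e => hezw (double_injective e).symm
        have h3 := ((hσ _ _).1 hxy).resolve_left fun e => hexy (double_injective e).symm
        rcases h1 with h1 | h1
        · refine Or.inl ⟨double_injective h1, double_injective ?_⟩
          rw [h2, h1, h3]
        · refine Or.inr ⟨double_injective (h1.trans h3.symm), double_injective ?_⟩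
          rw [h2, h1, hσ2]
      rw [pos_double, pos_double] at o1
      rcases hor with ⟨rfl, rfl⟩ | ⟨rfl, rfl⟩ <;> omega
    · have ne : ∀ p q, ¬ s (double p) (double q) → pos (double p) ≠ pos (double q) :=
        fun p q h e => h (pos_injective e ▸ s.refl' _)
      have k := hs.not_cross hxy hzw hxz
      have d1 := ne x z hxz
      have d2 := ne y z fun h => hxz (s.trans' hxy h)
      have d3 := ne x w fun h => hxz (s.trans' h (s.symm' hzw))
      have d4 := ne y w fun h => hxz (s.trans' hxy (s.trans' h (s.symm' hzw)))
      simp only [pos_double] at k d1 d2 d3 d4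
      omega
  have ex : ∀ p, ∃ q, boundary pos Set.univ a (p, true) (q, false) := by
    intro p
    obtain ⟨⟨q, c⟩, hq⟩ := double_surjective (σ (double (p, true)))
    have hpq : s (double (p, true)) (double (q, c)) := (hσ _ _).2 (Or.inr hq)
    have hb := hle hpq
    have hc : c = false := by
      by_contra hc
      have := boundary_eq pos_injective hb trivial trivial (by simpa using hc)
      rw [← this] at hq
      exact hσ1 _ hq.symm
    exact ⟨q, hc ▸ hb⟩
  have ha : IsPlanar a := noncrossing_of_exists_boundary pos_injective ex
  refine ⟨a, ha, (IsMatching.eq_of_le hm (isMatching_fatten ha) fun x y h => ?_).symm⟩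
  obtain ⟨x, rfl⟩ := double_surjective x
  obtain ⟨y, rfl⟩ := double_surjective y
  exact fatten_double.2 (hle h)

/-! ### Through strands -/

theorem throughStrands_eq (r : Setoid (Fin n ⊕ Fin n)) : throughStrands r =
    numBlocks r {x | (∃ i, r (Sum.inl i) x) ∧ ∃ j, r (Sum.inr j) x} := by
  unfold throughStrands numBlocks
  congr 1
  ext s
  constructor
  · rintro ⟨⟨x, rfl⟩, h1, h2⟩
    exact ⟨x, ⟨h1, h2⟩, rfl⟩
  · rintro ⟨x, ⟨h1, h2⟩, rfl⟩
    exact ⟨⟨x, rfl⟩, h1, h2⟩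

/-- The points of `T` form an initial or a final segment. Walking cyclically along a block that
meets both `T` and its complement, one leaves `T` exactly once, at the last point of the block in
`T`. -/
theorem ncard_crossing_chords {X : Type} [Finite X] {P : X → ℕ} (hP : Function.Injective P)
    {r : Setoid X} (hr : Noncrossing P r) (T : X → Prop)
    (hT : (∀ p q, T p → ¬ T q → P p < P q) ∨ ∀ p q, T p → ¬ T q → P q < P p) :
    {p | T p ∧ ∃ q, ¬ T q ∧ boundary P Set.univ r (p, true) (q, false)}.ncard =
      numBlocks r {x | (∃ p, T p ∧ r p x) ∧ ∃ q, ¬ T q ∧ r q x} := by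
  unfold numBlocks
  have himg : block r '' {x | (∃ p, T p ∧ r p x) ∧ ∃ q, ¬ T q ∧ r q x} =
      block r '' {p | T p ∧ ∃ q, ¬ T q ∧ boundary P Set.univ r (p, true) (q, false)} := by
    ext s
    constructor
    · rintro ⟨x, ⟨⟨p, hp, hpx⟩, ⟨q, hq, hqx⟩⟩, rfl⟩
      obtain ⟨p', ⟨hp1, hp2⟩, hmax⟩ := Set.exists_max_image {u | T u ∧ r u x} P (Set.toFinite _)
        ⟨p, hp, hpx⟩
      obtain ⟨q', hq'⟩ := exists_boundary_true hP hr p'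
      refine ⟨p', ⟨hp1, q', fun hTq => ?_, hq'⟩, block_eq.2 hp2⟩
      have h1 := hmax q' ⟨hTq, r.trans' (r.symm' hq'.1) hp2⟩
      have h2 := hq'.2 p' trivial q trivial (r.trans' hp2 (r.symm' hqx))
      simp only [Bool.toNat_true, Bool.toNat_false] at h2
      rcases hT with hT | hT
      · have := hT p' q hp1 hq
        omega
      · have := hT p' q hp1 hq
        have := hT q' q hTq hq
        omega
    · rintro ⟨p, ⟨hp, q, hq, hpq⟩, rfl⟩
      exact ⟨p, ⟨⟨p, hp, r.refl' p⟩, q, hq, r.symm' hpq.1⟩, rfl⟩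
  rw [himg]
  refine (Set.InjOn.ncard_image ?_).symm
  rintro p ⟨hp, q, hq, hpq⟩ p' ⟨hp', q', hq', hpq'⟩ e
  have e := block_eq.1 e
  have h1 := hpq.2 p trivial p' trivial e
  have h2 := hpq'.2 p trivial p' trivial e
  simp only [Bool.toNat_true, Bool.toNat_false] at h1 h2
  apply hP
  rcases hT with hT | hT
  · have := hT p q hp hq
    have := hT p' q hp' hq
    have := hT p q' hp hq'
    have := hT p' q' hp' hq'
    omega
  · have := hT p q hp hq
    have := hT p' q hp' hq
    have := hT p q' hp hq'
    have := hT p' q' hp' hq'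
    omega

/-- Going around a through block, the boundary passes once from top to bottom and once from bottom
to top; other blocks contribute nothing. Strands are represented by their `true` ends, which lie on
top in the first case and on the bottom in the second. -/
theorem throughStrands_fatten {a : Setoid (Fin n ⊕ Fin n)} (ha : IsPlanar a) :
    throughStrands (fatten a) = 2 * throughStrands a := by
  let T : Fin n ⊕ Fin n → Prop := fun x => x.isLeft
  have hTl : ∀ i : Fin n, T (Sum.inl i) := fun _ => rfl
  have hTr : ∀ i : Fin n, ¬ T (Sum.inr i) := fun _ => by simp [T]
  have hlt : ∀ p q, T p → ¬ T q → pos p < pos q := by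
    rintro (p | p) (q | q) hp hq
    · exact absurd (hTl q) hq
    · simp only [pos]
      omega
    · exact absurd hp (hTr p)
    · exact absurd hp (hTr p)
  have h1 := ncard_crossing_chords pos_injective ha T (Or.inl hlt)
  have h2 := ncard_crossing_chords pos_injective ha (fun x => ¬ T x)
    (Or.inr fun p q hp hq => hlt q p (not_not.1 hq) hp)
  have hthr : {x | (∃ p, T p ∧ a p x) ∧ ∃ q, ¬ T q ∧ a q x} =
      {x | (∃ i, a (Sum.inl i) x) ∧ ∃ j, a (Sum.inr j) x} := by
    ext x
    simp [T]
  have hthr' : {x | (∃ p, ¬ T p ∧ a p x) ∧ ∃ q, ¬ ¬ T q ∧ a q x} =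
      {x | (∃ i, a (Sum.inl i) x) ∧ ∃ j, a (Sum.inr j) x} := by
    ext x
    simp [T, and_comm]
  rw [hthr, ← throughStrands_eq] at h1
  rw [hthr', ← throughStrands_eq] at h2
  refine Eq.trans ?_ ((congrArg₂ (· + ·) h1 h2).trans (two_mul _).symm)
  rw [← Set.ncard_union_eq ?_ (Set.toFinite _) (Set.toFinite _), throughStrands_eq]
  swap
  · rw [Set.disjoint_left]
    rintro p ⟨hp, -⟩ ⟨hp', -⟩
    exact hp' hp
  unfold numBlocks
  have hTd : ∀ x c, T x ↔ ∃ i, double (x, c) = Sum.inl i := by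
    rintro (x | x) c <;> simp [T, double]
  have hTd' : ∀ x c, ¬ T x ↔ ∃ i, double (x, c) = Sum.inr i := by
    rintro (x | x) c <;> simp [T, double]
  rw [← Set.InjOn.ncard_image (f := fun p => block (fatten a) (double (p, true)))]
  swap
  · intro p _ q _ e
    exact congrArg Prod.fst (boundary_eq pos_injective (fatten_double.1 (block_eq.1 e))
      trivial trivial rfl)
  congr 1
  ext s
  constructor
  · rintro ⟨x, ⟨⟨i, hi⟩, ⟨j, hj⟩⟩, rfl⟩
    obtain ⟨⟨u, c⟩, hu⟩ := double_surjective (Sum.inl i)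
    obtain ⟨⟨v, d⟩, hv⟩ := double_surjective (Sum.inr j)
    have hTu := (hTd u c).2 ⟨i, hu⟩
    have hTv := (hTd' v d).2 ⟨j, hv⟩
    rw [← hu] at hi
    rw [← hv] at hj
    have huv := fatten_double.1 (Setoid.trans' _ hi (Setoid.symm' _ hj))
    cases c <;> cases d
    · exact absurd (congrArg Prod.fst (boundary_eq pos_injective huv trivial trivial rfl))
        fun e => hTv ((show u = v from e) ▸ hTu)
    · exact ⟨v, Or.inr ⟨hTv, u, not_not.2 hTu, Setoid.symm' _ huv⟩, block_eq.2 hj⟩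
    · exact ⟨u, Or.inl ⟨hTu, v, hTv, huv⟩, block_eq.2 hi⟩
    · exact absurd (congrArg Prod.fst (boundary_eq pos_injective huv trivial trivial rfl))
        fun e => hTv ((show u = v from e) ▸ hTu)
  · rintro ⟨p, ⟨hp, q, hq, hpq⟩ | ⟨hp, q, hq, hpq⟩, rfl⟩
    · obtain ⟨i, hi⟩ := (hTd p true).1 hp
      obtain ⟨j, hj⟩ := (hTd' q false).1 hq
      exact ⟨_, ⟨⟨i, hi ▸ Setoid.refl' _ _⟩, j, hj ▸ fatten_double.2 (Setoid.symm' _ hpq)⟩, rfl⟩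
    · obtain ⟨i, hi⟩ := (hTd' p true).1 hp
      obtain ⟨j, hj⟩ := (hTd q false).1 (not_not.1 hq)
      exact ⟨_, ⟨⟨j, hj ▸ fatten_double.2 (Setoid.symm' _ hpq)⟩, i, hi ▸ Setoid.refl' _ _⟩, rfl⟩

theorem throughStrands_id (n : ℕ) : throughStrands (idDiagram (Fin n)) = n := by
  rw [throughStrands_eq]
  have : {x | (∃ i, idDiagram (Fin n) (Sum.inl i) x) ∧ ∃ j, idDiagram (Fin n) (Sum.inr j) x} =
      Set.univ := Set.eq_univ_of_forall fun x => ⟨⟨Sum.elim id id x, rfl⟩, Sum.elim id id x, rfl⟩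
  rw [this]
  unfold numBlocks
  have h := ncard_image_congr (A := Set.univ) (f := block (idDiagram (Fin n)))
    (g := Sum.elim id id) fun u _ v _ => block_eq
  have hs : (Sum.elim id id : Fin n ⊕ Fin n → Fin n) '' Set.univ = Set.univ :=
    Set.eq_univ_of_forall fun i => ⟨Sum.inl i, trivial, rfl⟩
  rw [h, hs, Set.ncard_univ, Nat.card_eq_fintype_card, Fintype.card_fin]

/-! ### Regularity -/

/-- The reflection of a diagram in a horizontal line. -/
def flip (a : Setoid (Fin n ⊕ Fin n)) : Setoid (Fin n ⊕ Fin n) := a.comap Sum.swap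

theorem isPlanar_flip {a : Setoid (Fin n ⊕ Fin n)} (ha : IsPlanar a) : IsPlanar (flip a) := by
  have h : ∀ x : Fin n ⊕ Fin n, pos x.swap = 2 * n - 1 - pos x := by
    rintro (x | x) <;> simp only [pos, Sum.swap_inl, Sum.swap_inr]
    omega
  intro w x y z h1 h2 h3 hwy hxz
  have l := pos_lt z
  have := ha z.swap y.swap x.swap w.swap (by rw [h, h]; omega) (by rw [h, h]; omega)
    (by rw [h, h]; omega) (a.symm' hxz) (a.symm' hwy)
  exact a.trans' hwy (a.trans' (a.symm' this) (a.symm' hxz))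

/-- Reading both rows of a*a as bottom points of `a` only joins points already joined in `a`, so
nothing new arises. Conversely, a*a joins the two copies of every bottom point lying on a through
block, so no through connection is lost. -/
theorem comp_flip_comp (a : Setoid (Fin n ⊕ Fin n)) : comp a (comp (flip a) a) = a := by
  have h1 : comp (flip a) a ≤ a.comap (Sum.elim Sum.inr Sum.inr) := by
    have : stack (flip a) a ≤ a.comap (Sum.elim Sum.inr (Sum.elim Sum.inl Sum.inr)) := by
      refine stack_le ?_ ?_
      · rintro (x | x) (y | y) h <;> exact h
      · rintro (x | x) (y | y) h <;> exact h
    rintro (x | x) (y | y) h <;> exact this h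
  have h2 : ∀ {x y}, a (Sum.inl x) (Sum.inr y) → comp (flip a) a (Sum.inl y) (Sum.inr y) :=
    fun {x y} h => Setoid.trans' (stack (flip a) a)
      (stack_upper (flip a) a (x := Sum.inl y) (y := Sum.inr x) (a.symm' h))
      (stack_lower (flip a) a (x := Sum.inl x) (y := Sum.inr y) h)
  refine le_antisymm ?_ ?_
  · have : stack a (comp (flip a) a) ≤ a.comap (Sum.elim Sum.inl (Sum.elim Sum.inr Sum.inr)) := by
      refine stack_le ?_ fun x y h => ?_
      · rintro (x | x) (y | y) h <;> exact h
      · exact h1 h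
    rintro (x | x) (y | y) h <;> exact this h
  · have mixed : ∀ {x y}, a (Sum.inl x) (Sum.inr y) →
        comp a (comp (flip a) a) (Sum.inl x) (Sum.inr y) := fun {x y} h =>
      Setoid.trans' (stack a (comp (flip a) a))
        (stack_upper a (comp (flip a) a) (x := Sum.inl x) (y := Sum.inr y) h)
        (stack_lower a (comp (flip a) a) (x := Sum.inl y) (y := Sum.inr y) (h2 h))
    rintro (x | x) (y | y) h
    · exact stack_upper a (comp (flip a) a) (x := Sum.inl x) (y := Sum.inl y) h
    · exact mixed h
    · exact Setoid.symm' _ (mixed (a.symm' h))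
    · have hb : comp (flip a) a (Sum.inr x) (Sum.inr y) :=
        stack_lower (flip a) a (x := Sum.inr x) (y := Sum.inr y) h
      exact stack_lower a (comp (flip a) a) (x := Sum.inr x) (y := Sum.inr y) hb

end Correspondence

/-! ### The embedding of cyclic monoids and of their truncations, and factorization through its
image. -/

section Embedding

variable {m n k l : ℕ}

theorem comp_fatten {a b : Setoid (Fin n ⊕ Fin n)} (ha : IsPlanar a) (hb : IsPlanar b) :
    comp (fatten a) (fatten b) = fatten (comp a b) :=
  (comp_fatten_and_internal_fatten ha hb).1

/-- By surjectivity the identity matching is some `fatten a`, and `fatten (idDiagram (Fin n))` is a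
left identity for it. -/
theorem fatten_id (n : ℕ) : fatten (idDiagram (Fin n)) = idDiagram (Fin (2 * n)) := by
  obtain ⟨a, ha, h⟩ := exists_fatten_eq (n := n) isPlanar_id isMatching_id
  have := comp_fatten isPlanar_id ha
  rwa [id_comp, h, comp_id] at this

/-- Euler's formula for the product of the identity with itself. -/
theorem numBlocks_id (n : ℕ) : numBlocks (idDiagram (Fin n)) Set.univ = n := by
  have := (comp_fatten_and_internal_fatten (n := n) isPlanar_id isPlanar_id).2
  rw [fatten_id, internal_id_left, internal_id_left, id_comp] at this
  omega

/-- Doubling, from residues modulo `m` to residues modulo `2 * m`. -/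
def doubleResidue (m : ℕ) : ZMod m →+ ZMod (2 * m) :=
  ZMod.lift m ⟨(AddMonoidHom.mulLeft (2 : ZMod (2 * m))).comp (Int.castAddHom _), by
    have := ZMod.natCast_self (2 * m)
    push_cast at this
    simpa using this⟩

theorem doubleResidue_natCast (j : ℕ) : doubleResidue m j = 2 * (j : ZMod (2 * m)) := by
  have := ZMod.lift_coe m ⟨(AddMonoidHom.mulLeft (2 : ZMod (2 * m))).comp (Int.castAddHom _), by
    have := ZMod.natCast_self (2 * m)
    push_cast at this
    simpa using this⟩ (j : ℤ)
  simpa [doubleResidue] using this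

theorem doubleResidue_injective : Function.Injective (doubleResidue m) := by
  refine (ZMod.lift_injective _).2 fun z hz => ?_
  have hz : (2 : ZMod (2 * m)) * ((z : ℤ) : ZMod (2 * m)) = 0 := hz
  have h2 : ((2 * z : ℤ) : ZMod (2 * m)) = 0 := by
    push_cast
    exact hz
  rw [ZMod.intCast_zmod_eq_zero_iff_dvd] at h2 ⊢
  push_cast at h2
  exact (mul_dvd_mul_iff_left (by norm_num)).1 h2

/-- Fattening of diagrams, with the number of loops given by Euler's formula. -/
noncomputable def fattenCyclic (x : CyclicPartition m n) : CyclicPartition (2 * m) (2 * n) :=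
  ⟨fatten x.skeleton, doubleResidue m x.bubbles + numBlocks x.skeleton Set.univ - n⟩

theorem fattenCyclic_one : fattenCyclic (1 : CyclicPartition m n) = 1 := by
  refine CyclicPartition.ext (fatten_id n) ?_
  change doubleResidue m 0 + (numBlocks (idDiagram (Fin n)) Set.univ : ZMod (2 * m)) - n = 0
  rw [numBlocks_id, map_zero, zero_add, sub_self]

/-- By Euler's formula the loop count differs from 2Φ by the coboundary of the block count minus n,
which the correction term in `fattenCyclic` absorbs. -/
theorem fattenCyclic_mul {x y : CyclicPartition m n} (hx : IsPlanar x.skeleton)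
    (hy : IsPlanar y.skeleton) : fattenCyclic (x * y) = fattenCyclic x * fattenCyclic y := by
  obtain ⟨h1, h2⟩ := comp_fatten_and_internal_fatten hx hy
  refine CyclicPartition.ext h1.symm ?_
  change doubleResidue m (x.bubbles + y.bubbles + (internal x.skeleton y.skeleton : ZMod m)) +
      (numBlocks (comp x.skeleton y.skeleton) Set.univ : ZMod (2 * m)) - n =
    (doubleResidue m x.bubbles + (numBlocks x.skeleton Set.univ : ZMod (2 * m)) - n) +
      (doubleResidue m y.bubbles + (numBlocks y.skeleton Set.univ : ZMod (2 * m)) - n) +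
      (internal (fatten x.skeleton) (fatten y.skeleton) : ZMod (2 * m))
  have h3 := congrArg (Nat.cast : ℕ → ZMod (2 * m)) h2
  push_cast at h3
  rw [map_add, map_add, doubleResidue_natCast]
  linear_combination -h3

theorem fattenCyclic_injective {x y : CyclicPartition m n} (hx : IsPlanar x.skeleton)
    (hy : IsPlanar y.skeleton) (h : fattenCyclic x = fattenCyclic y) : x = y := by
  have h1 : x.skeleton = y.skeleton :=
    fatten_injective hx hy (congrArg CyclicPartition.skeleton h)
  refine CyclicPartition.ext h1 (doubleResidue_injective ?_)
  have h2 : doubleResidue m x.bubbles + (numBlocks x.skeleton Set.univ : ZMod (2 * m)) - n =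
      doubleResidue m y.bubbles + (numBlocks y.skeleton Set.univ : ZMod (2 * m)) - n :=
    congrArg CyclicPartition.bubbles h
  rw [h1] at h2
  linear_combination h2

/-- Fattening of the diagrams with at most `l` through strands. -/
noncomputable def fattenHom (m n l : ℕ) : atMost (planarPartitionMonoid m n) l →*
    atMost (temperleyLiebMonoid (2 * m) (2 * n)) (2 * l) where
  toFun x := ⟨fattenCyclic x.1, ⟨isPlanar_fatten _, isMatching_fatten x.2.1⟩, by
    rcases x.2.2 with h | h
    · exact Or.inl (by rw [h, fattenCyclic_one])
    · refine Or.inr ?_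
      change throughStrands (fatten _) ≤ _
      rw [throughStrands_fatten x.2.1]
      omega⟩
  map_one' := Subtype.ext fattenCyclic_one
  map_mul' x y := Subtype.ext (fattenCyclic_mul x.2.1 y.2.1)

theorem throughStrands_fattenHom (x : atMost (planarPartitionMonoid m n) l) :
    throughStrands (fattenHom m n l x).1.skeleton = 2 * throughStrands x.1.skeleton :=
  throughStrands_fatten x.2.1

/-- The embedding of the truncated planar partition monoid into the truncated Temperley–Lieb
monoid. -/
noncomputable def truncationHom (m n k l : ℕ) : Truncation (planarPartitionMonoid m n) k l →*
    Truncation (temperleyLiebMonoid (2 * m) (2 * n)) (2 * k) (2 * l) :=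
  Con.lift _ ((Con.mk' _).comp (fattenHom m n l)) (by
    intro x y h
    refine (Con.eq _).2 ?_
    rcases h with h | h
    · exact Or.inl (congrArg _ h)
    · refine Or.inr ?_
      rw [throughStrands_fattenHom, throughStrands_fattenHom]
      omega)

theorem truncationHom_injective : Function.Injective (truncationHom m n k l) := by
  intro x y
  induction x using Con.induction_on with | _ x => ?_
  induction y using Con.induction_on with | _ y => ?_
  intro h
  refine (Con.eq _).2 ?_
  rcases (Con.eq _).1 h with h | h
  · exact Or.inl (Subtype.ext (fattenCyclic_injective x.2.1 y.2.1 (congrArg Subtype.val h)))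
  · refine Or.inr ?_
    rw [throughStrands_fattenHom, throughStrands_fattenHom] at h
    omega

/-- The identity has n ≥ k through strands, so it is not collapsed. A product beginning with a
nonidentity element has at most l < n through strands. -/
theorem eq_one_of_isUnit {P : Submonoid (CyclicPartition m n)} (hk : k ≤ n) (hl : l < n)
    {x : atMost P l} (hx : IsUnit (x : Truncation P k l)) : x = 1 := by
  obtain ⟨y, hy⟩ := hx.exists_right_inv
  induction y using Con.induction_on with | _ y => ?_
  have h1 : throughStrands (1 : CyclicPartition m n).skeleton = n := throughStrands_id n
  rcases (Con.eq _).1 (show ((x * y : atMost P l) : Truncation P k l) = (1 : atMost P l) from hy)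
    with h | h
  · rcases x.2.2 with h2 | h2
    · exact Subtype.ext h2
    · have h3 := throughStrands_comp_le_left x.1.skeleton y.1.skeleton
      have h4 : comp x.1.skeleton y.1.skeleton = (1 : CyclicPartition m n).skeleton :=
        congrArg (fun z : atMost P l => z.1.skeleton) h
      rw [h4, h1] at h3
      omega
  · have h2 : throughStrands (1 : CyclicPartition m n).skeleton < k := h.2
    omega

/-- Write the diagram of `y` as `fatten a` and use a = a(a*a). The factor a*a has at most l through
strands, so it is not the identity. -/
theorem exists_eq_mul_fattenHom (hl : l < n)
    {y : atMost (temperleyLiebMonoid (2 * m) (2 * n)) (2 * l)} (hy : y ≠ 1) :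
    ∃ y' x, x ≠ 1 ∧ y = y' * fattenHom m n l x := by
  obtain ⟨⟨s, c⟩, hP, hs⟩ := y
  obtain ⟨a, ha, rfl⟩ := exists_fatten_eq hP.1 hP.2
  have hs : throughStrands (fatten a) ≤ 2 * l := hs.resolve_left fun h => hy (Subtype.ext h)
  rw [throughStrands_fatten ha] at hs
  have hle : throughStrands (comp (flip a) a) ≤ l :=
    (throughStrands_comp_le_right _ _).trans (by omega)
  have hpl : IsPlanar (comp (flip a) a) := (isPlanar_flip ha).comp ha
  let x : atMost (planarPartitionMonoid m n) l := ⟨⟨comp (flip a) a, 0⟩, hpl, Or.inr hle⟩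
  -- The left factor may be any element of the Temperley–Lieb monoid, so its residue is chosen to
  -- cancel both the residue of the image of `x` and the loops formed.
  refine ⟨⟨⟨fatten a, c - (fattenHom m n l x).1.bubbles -
    (internal (fatten a) (fatten (comp (flip a) a)) : ZMod (2 * m))⟩, hP, Or.inr ?_⟩, x, ?_, ?_⟩
  · change throughStrands (fatten a) ≤ _
    rw [throughStrands_fatten ha]
    exact hs
  · intro h
    have h1 : comp (flip a) a = idDiagram (Fin n) :=
      congrArg (fun z : atMost (planarPartitionMonoid m n) l => z.1.skeleton) h
    rw [h1, throughStrands_id] at hle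
    omega
  · refine Subtype.ext (CyclicPartition.ext ?_ ?_)
    · change fatten a = comp (fatten a) (fatten (comp (flip a) a))
      rw [comp_fatten ha hpl, comp_flip_comp]
    · change c = c - (fattenHom m n l x).1.bubbles - _ + (fattenHom m n l x).1.bubbles + _
      change _ = c - (fattenHom m n l x).1.bubbles -
        (internal (fatten a) (fatten (comp (flip a) a)) : ZMod (2 * m)) +
        (fattenHom m n l x).1.bubbles +
        (internal (fatten a) (fatten (comp (flip a) a)) : ZMod (2 * m))
      ring

theorem throughStrands_bot : throughStrands (⊥ : Setoid (Fin n ⊕ Fin n)) = 0 := by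
  rw [throughStrands_eq]
  have : {x : Fin n ⊕ Fin n | (∃ i, (⊥ : Setoid (Fin n ⊕ Fin n)) (Sum.inl i) x) ∧
      ∃ j, (⊥ : Setoid (Fin n ⊕ Fin n)) (Sum.inr j) x} = ∅ := by
    rw [Set.eq_empty_iff_forall_notMem]
    rintro x ⟨⟨i, hi⟩, ⟨j, hj⟩⟩
    have : (Sum.inl i : Fin n ⊕ Fin n) = Sum.inr j := Eq.trans hi (Eq.symm hj)
    simp at this
  rw [this, numBlocks, Set.image_empty, Set.ncard_empty]

/-- The diagram all of whose blocks are singletons. -/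
def singletons (m n l : ℕ) : atMost (planarPartitionMonoid m n) l :=
  ⟨⟨⊥, 0⟩, fun w x y z h1 h2 _ h _ => by
    have h : w = y := h
    subst h
    omega, Or.inr (throughStrands_bot.trans_le l.zero_le)⟩

/-- The image has no through strands, hence is the zero of the truncation as 2k > 0. -/
theorem mul_truncationHom_singletons (hk : 1 ≤ k)
    (t : Truncation (temperleyLiebMonoid (2 * m) (2 * n)) (2 * k) (2 * l)) :
    t * truncationHom m n k l (singletons m n l) = truncationHom m n k l (singletons m n l) := by
  induction t using Con.induction_on with | _ t => ?_
  have h0 : throughStrands (fattenHom m n l (singletons m n l)).1.skeleton = 0 := by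
    rw [throughStrands_fattenHom]
    exact congrArg (2 * ·) throughStrands_bot
  refine (Con.eq _).2 (Or.inr ⟨?_, by omega⟩)
  have := throughStrands_comp_le_right t.1.skeleton
    (fattenHom m n l (singletons m n l)).1.skeleton
  change throughStrands (comp _ _) < _
  omega

end Embedding

end CyclicDiagram

/-! ### Transfer of triviality along an embedding, and the inequality of gaps. -/

namespace RepGap

universe u v

/-- A monoid with at most two elements has only the trivial submonoid and itself. This handles the
convention on exceptional monoids; it is the only place where injectivity of the embedding matters
for the transfer of triviality. -/
theorem IsExceptional.of_injective {S T : Type v} [Monoid S] [Monoid T] (f : S →* T)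
    (hf : Function.Injective f) (hT : IsExceptional T) : IsExceptional S := by
  by_cases hS : ∀ s : S, s = 1
  · have : Unique S := ⟨⟨1⟩, hS⟩
    exact Or.inl ⟨MulEquiv.ofUnique⟩
  push Not at hS
  obtain ⟨s, hs⟩ := hS
  have hfs : f s ≠ 1 := fun h => hs (hf (h.trans f.map_one.symm))
  rcases hT with ⟨⟨e⟩⟩ | ⟨⟨e⟩⟩
  · exact absurd (e.injective (Subsingleton.elim _ _)) hfs
  · have h0 : ∀ t, t ≠ 1 → e t = 0 := fun t ht => by
      by_contra h
      obtain ⟨c, hc⟩ := WithZero.ne_zero_iff_exists.1 h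
      exact ht (e.injective (by rw [← hc, map_one]; rfl))
    refine Or.inr ⟨(MulEquiv.ofBijective f ⟨hf, fun t => ?_⟩).trans e⟩
    by_cases ht : t = 1
    · exact ⟨1, by rw [map_one, ht]⟩
    · exact ⟨s, e.injective ((h0 _ hfs).trans (h0 t ht).symm)⟩

/-- A criterion for triviality to pass from a submonoid to the whole monoid. -/
theorem IsTrivialUpTo.of_injective {K : Type u} [Field K] {S T : Type v} [Monoid S] [Monoid T]
    (f : S →* T) (hf : Function.Injective f) (z : S) (hz : ∀ t, t * f z = f z)
    (hu : ∀ t : T, IsUnit t → t = 1)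
    (hfac : ∀ t : T, ¬ IsUnit t → ∃ t' s, ¬ IsUnit s ∧ t = t' * f s) {d : ℤ}
    (h : IsTrivialUpTo K S d) : IsTrivialUpTo K T d := by
  refine ⟨fun hT => h.1 (hT.of_injective f hf), fun V _ _ _ ρ hV => ?_⟩
  obtain ⟨e, b, hb⟩ := h.2 V (ρ.comp f) hV
  refine ⟨e, b, fun i => ?_⟩
  rcases hb i with h1 | h1
  -- Here the zero fixes the basis vector, so t v = t (0 v) = (t 0) v = 0 v = v, where 0 denotes the
  -- zero element of the monoid.
  · left
    intro t
    have hz1 : ρ (f z) (b i) = b i := h1 z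
    have : ρ (t * f z) (b i) = ρ t (ρ (f z) (b i)) := by rw [map_mul]; rfl
    rw [hz, hz1] at this
    exact this.symm
  -- Units of `T` reduce to 1. A nonunit has a right factor coming from a nonunit of `S`, which
  -- kills the vector.
  · right
    refine fun t => ⟨fun ht => by rw [hu t ht, map_one]; rfl, fun ht => ?_⟩
    obtain ⟨t', s, hs, rfl⟩ := hfac t ht
    have hs0 : ρ (f s) (b i) = 0 := (h1 s).2 hs
    rw [map_mul]
    change ρ t' (ρ (f s) (b i)) = 0
    rw [hs0, map_zero]

end RepGap

theorem mainTheorem9 {K : Type*} [Field K] (m n k l : ℕ) (hk : 1 ≤ k) (hkl : k ≤ l) (hln : l < n)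
    (hK : ¬ ringChar K ∣ 2 * m) :
    RepGap.gap K
        (CyclicDiagram.Truncation (CyclicDiagram.planarPartitionMonoid m n) k l) ≤
      RepGap.gap K
        (CyclicDiagram.Truncation
          (CyclicDiagram.temperleyLiebMonoid (2 * m) (2 * n)) (2 * k) (2 * l)) := by
  -- The set of admissible g on the left is contained in the one on the right.
  refine sSup_le_sSup ?_
  rintro _ ⟨d, rfl, hd⟩
  refine ⟨d, rfl, hd.of_injective (CyclicDiagram.truncationHom m n k l)
    CyclicDiagram.truncationHom_injective (CyclicDiagram.singletons m n l)
    (CyclicDiagram.mul_truncationHom_singletons hk) (fun t ht => ?_) fun t ht => ?_⟩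
  · induction t using Con.induction_on with | _ t => ?_
    rw [CyclicDiagram.eq_one_of_isUnit (by omega) (by omega) ht]
    rfl
  · induction t using Con.induction_on with | _ t => ?_
    obtain ⟨t', s, hs, rfl⟩ := CyclicDiagram.exists_eq_mul_fattenHom (m := m) hln
      (y := t) fun h => ht (by rw [h]; exact isUnit_one)
    exact ⟨t', s, fun h => hs (CyclicDiagram.eq_one_of_isUnit (by omega) hln h), rfl⟩
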